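/- For $m\ge 0$ let $S_m$ be the group of permutations of $\{1,\dots,m\}$, and regard $S_{n-1}$ as the subgroup of $S_n$ of permutations fixing $n$. Let $H_r(-)$ denote group homology with trivial coefficients $\mathbb{Z}$. (a) For all integers $r\ge 0$ and $n>2r$, the homomorphism $H_r(S_{n-1})\to H_r(S_n)$ induced by the inclusion $S_{n-1}\subset S_n$ is an isomorphism. (b) For $n\ge 1$ let $X(n)$ be the $\Delta$-complex that has one ordered $k$-simplex for each sequence of $k+1$ distinct elements of $\{1,\dots,n\}$, whose faces are given by the subsequences obtained by deleting one entry. Then $X(n)$ is $(n-1)$-spherical, that is, it is nonempty and its reduced integral homology satisfies $\tilde H_i(X(n))=0$ for all $i\ne n-1$. -/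

import Mathlib

noncomputable section

/-! ### Homology of the symmetric groups -/

namespace SymmetricGroup

/-- The standard inclusion of the symmetric group on `m` letters into the symmetric group on
`m + 1` letters: a permutation is extended by fixing the last letter. -/
def stabilization (m : ℕ) : Equiv.Perm (Fin m) →* Equiv.Perm (Fin (m + 1)) :=
  Equiv.Perm.extendDomainHom (finSuccAboveEquiv (Fin.last m))

theorem stabilization_castSucc (m : ℕ) (σ : Equiv.Perm (Fin m)) (i : Fin m) :
    stabilization m σ i.castSucc = (σ i).castSucc := by
  have h := Equiv.Perm.extendDomain_apply_image σ (finSuccAboveEquiv (Fin.last m)) i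
  simpa [finSuccAboveEquiv_apply, stabilization] using h

theorem stabilization_last (m : ℕ) (σ : Equiv.Perm (Fin m)) :
    stabilization m σ (Fin.last m) = Fin.last m :=
  Equiv.Perm.extendDomain_apply_not_subtype σ _ (by simp)

/-- The integral group homology `H_r(S_m; ℤ)`, with trivial coefficients. -/
abbrev homology (m r : ℕ) : ModuleCat ℤ :=
  groupHomology (Rep.trivial ℤ (Equiv.Perm (Fin m)) ℤ) r

/-- The map `H_r(S_m; ℤ) ⟶ H_r(S_{m+1}; ℤ)` induced by the standard inclusion (and by the
identity of the coefficients). -/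
def homologyStabilization (m r : ℕ) : homology m r ⟶ homology (m + 1) r :=
  groupHomology.map (stabilization m)
    (Rep.ofHom ⟨LinearMap.id, fun _ => rfl⟩ :
      Rep.trivial ℤ (Equiv.Perm (Fin m)) ℤ ⟶
        Rep.res (stabilization m) (Rep.trivial ℤ (Equiv.Perm (Fin (m + 1))) ℤ)) r

end SymmetricGroup

/-! ### Δ-complexes and their reduced homology -/

/-- The combinatorial data of a Δ-complex: the sets of ordered `k`-simplices and the face maps
(`face i` deletes the `i`-th vertex), subject to the usual identities. -/
structure DeltaComplex where
  Simplex : ℕ → Type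
  face : ∀ {k : ℕ}, Fin (k + 2) → Simplex (k + 1) → Simplex k
  face_face : ∀ {k : ℕ} {i j : Fin (k + 2)}, i ≤ j → ∀ x : Simplex (k + 2),
    face i (face j.succ x) = face j (face i.castSucc x)

namespace DeltaComplex

open CategoryTheory

variable (X : DeltaComplex)

/-- The simplicial boundary `∂ x = ∑ᵢ (-1)ⁱ dᵢ x` on the free abelian groups on the simplices. -/
def boundary (k : ℕ) : (X.Simplex (k + 1) →₀ ℤ) →ₗ[ℤ] (X.Simplex k →₀ ℤ) :=
  ∑ i : Fin (k + 2), (-1 : ℤ) ^ (i : ℕ) • Finsupp.lmapDomain ℤ ℤ (X.face i)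

theorem boundary_single (k : ℕ) (x : X.Simplex (k + 1)) (a : ℤ) :
    X.boundary k (Finsupp.single x a) =
      ∑ i : Fin (k + 2), (-1 : ℤ) ^ (i : ℕ) • Finsupp.single (X.face i x) a := by
  simp [boundary, LinearMap.sum_apply, Finsupp.mapDomain_single]

theorem boundary_comp_boundary (k : ℕ) : X.boundary k ∘ₗ X.boundary (k + 1) = 0 := by
  refine Finsupp.lhom_ext fun x a => ?_
  rw [LinearMap.comp_apply, boundary_single, map_sum]
  simp only [map_zsmul, boundary_single, Finset.smul_sum, smul_smul, LinearMap.zero_apply]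
  rw [Finset.sum_comm, ← Finset.sum_product', Finset.univ_product_univ]
  let S : Finset (Fin (k + 2) × Fin (k + 3)) := {ij | (ij.2 : ℕ) ≤ (ij.1 : ℕ)}
  rw [← Finset.sum_add_sum_compl S, ← eq_neg_iff_add_eq_zero, ← Finset.sum_neg_distrib]
  refine Finset.sum_bij (fun ij hij => (Fin.castLT ij.2
    (lt_of_le_of_lt (Finset.mem_filter.mp hij).right (Fin.is_lt ij.1)), ij.1.succ)) ?_ ?_ ?_ ?_
  · intro ij hij
    simp only [S, Finset.compl_filter, Finset.mem_filter_univ, Fin.val_succ,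
      Fin.val_castLT] at hij ⊢
    lia
  · rintro ⟨i, j⟩ hij ⟨i', j'⟩ hij' h
    simp only [Prod.mk.injEq, Fin.ext_iff, Fin.val_succ, Fin.val_castLT] at h ⊢
    lia
  · rintro ⟨i, j⟩ hij
    simp only [S, Finset.compl_filter, Finset.mem_filter_univ, not_le] at hij
    refine ⟨(j.pred (by rintro rfl; simp at hij), i.castSucc), ?_, ?_⟩
    · simp only [S, Finset.mem_filter_univ, Fin.val_castSucc, Fin.val_pred]
      lia
    · simp
  · rintro ⟨i, j⟩ hij
    simp only [S, Finset.mem_filter_univ] at hij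
    obtain ⟨j, rfl⟩ : ∃ j' : Fin (k + 2), j = j'.castSucc :=
      ⟨j.castLT (lt_of_le_of_lt hij i.is_lt), by simp⟩
    rw [← neg_smul]
    simp only [Fin.castLT_castSucc, Fin.val_succ, Fin.val_castSucc]
    rw [X.face_face (show j ≤ i from hij)]
    congr 1
    ring

/-- The simplicial chain complex of a Δ-complex, with integral coefficients. -/
def chainComplex : ChainComplex (ModuleCat ℤ) ℕ :=
  ChainComplex.of (fun k => ModuleCat.of ℤ (X.Simplex k →₀ ℤ))
    (fun k => ModuleCat.ofHom (X.boundary k))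
    (fun k => by rw [← ModuleCat.ofHom_comp, boundary_comp_boundary]; rfl)

/-- The augmentation, which sends every vertex to `1`. -/
def augmentation : (X.Simplex 0 →₀ ℤ) →ₗ[ℤ] ℤ :=
  Finsupp.linearCombination ℤ fun _ => (1 : ℤ)

theorem augmentation_comp_boundary : X.augmentation ∘ₗ X.boundary 0 = 0 := by
  refine Finsupp.lhom_ext fun x a => ?_
  rw [LinearMap.comp_apply, boundary_single, Fin.sum_univ_two]
  simp [augmentation]

theorem chainComplex_d_comp_augmentation :
    X.chainComplex.d 1 0 ≫ ModuleCat.ofHom X.augmentation = 0 := by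
  have h : ModuleCat.ofHom (X.boundary 0) ≫ ModuleCat.ofHom X.augmentation = 0 := by
    rw [← ModuleCat.ofHom_comp, augmentation_comp_boundary]
    rfl
  have h' : X.chainComplex.d 1 0 = ModuleCat.ofHom (X.boundary 0) :=
    ChainComplex.of_d (fun k => ModuleCat.of ℤ (X.Simplex k →₀ ℤ))
      (fun k => ModuleCat.ofHom (X.boundary k)) 0
  exact (congrArg (fun f => f ≫ ModuleCat.ofHom X.augmentation) h').trans h

/-- The augmented chain complex, indexed so that the `k`-simplices sit in degree `k + 1`. -/
def augmentedChainComplex : ChainComplex (ModuleCat ℤ) ℕ :=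
  X.chainComplex.augment (ModuleCat.ofHom X.augmentation) X.chainComplex_d_comp_augmentation

/-- The reduced integral homology group in degree `i ≥ 0`. -/
def reducedHomology (i : ℕ) : ModuleCat ℤ :=
  X.augmentedChainComplex.homology (i + 1)

/-- `X` is `d`-spherical: it is nonempty, and its reduced homology vanishes in all degrees other
than `d` (in degree `-1` it vanishes because `X` is nonempty). -/
def IsSpherical (d : ℕ) : Prop :=
  Nonempty (X.Simplex 0) ∧ ∀ i : ℕ, i ≠ d → Limits.IsZero (X.reducedHomology i)

end DeltaComplex

/-- The complex of ordered subsets of an `n`-element set: its `k`-simplices are the sequences of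
`k + 1` distinct elements, and the faces are obtained by deleting one entry. -/
def orderedSubsetComplex (n : ℕ) : DeltaComplex where
  Simplex k := Fin (k + 1) ↪ Fin n
  face i x := (Fin.succAboveEmb i).trans x
  face_face {k i j} hij x := by
    ext l
    have h := congrArg (fun f => f.toOrderHom l) (SimplexCategory.δ_comp_δ hij)
    exact congrArg (fun t => ((x t : Fin n) : ℕ)) h

end

/-!
The injective words in `n` letters form a complex, augmented by the empty word, on which the
symmetric group `S_n` acts. It is acyclic below its top degree: a cycle is modified by boundaries,
one position of a fixed letter at a time, until that letter no longer occurs in it, and then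
prefixing the letter is a contraction.

The words of length `p` are permuted transitively, so by Shapiro's lemma the homology of `S_n`
with coefficients in the permutation module on them is that of the stabilizer `S_{n-p}`. The faces
of a word of length `p + 1` differ by permutations commuting with its stabilizer, and conjugations
act trivially on homology, so all of them induce the stabilization map, and the boundary operator
induces their alternating sum: the stabilization map for even `p` and zero for odd `p`. By
induction on the homological degree, the maps for even `p > 0` are isomorphisms in lower degrees.
The long exact sequences of the modules of cycles then show that the map for `p = 0` is an
isomorphism as well.
-/

noncomputable section

open CategoryTheory MonoidalCategory

universe u

namespace HomologicalStability

open Rep MonoidAlgebra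

variable {k G H : Type u} [CommRing k] [Group G] [Group H]

/-- The morphism of representations given by an equivariant linear map. -/
def homMk {A B : Rep.{u} k G} (f : A →ₗ[k] B) (h : ∀ g a, f (A.ρ g a) = B.ρ g (f a)) : A ⟶ B :=
  Rep.ofHom ⟨f, fun g => LinearMap.ext fun a => h g a⟩

theorem hom_ext_apply {A B : Rep.{u} k G} {φ ψ : A ⟶ B} (h : ∀ a, φ.hom a = ψ.hom a) : φ = ψ :=
  Rep.hom_ext (Representation.IntertwiningMap.ext (LinearMap.ext h))

/-- The tensor product `k[X] ⊗ B` of a permutation module with `B`, with the diagonal action. -/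
abbrev permTensor (X : Type u) [MulAction G X] (B : Rep.{u} k G) : Rep.{u} k G :=
  ofMulAction k G X ⊗ B

section permTensor

variable {X : Type u} [MulAction G X] {A B : Rep.{u} k G} {M : Type*} [AddCommGroup M] [Module k M]

/-- The map `b ↦ x ⊗ b`. -/
def permTensorSingle (x : X) : B →ₗ[k] permTensor X B :=
  TensorProduct.mk k k[X] B (MonoidAlgebra.single x 1)

theorem permTensor_ρ_single (g : G) (x : X) (b : B) :
    (permTensor X B).ρ g (permTensorSingle x b) = permTensorSingle (g • x) (B.ρ g b) := by
  simp [permTensorSingle]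

theorem permTensor_linearMap_ext {f g : permTensor X B →ₗ[k] M}
    (h : ∀ x b, f (permTensorSingle x b) = g (permTensorSingle x b)) : f = g :=
  TensorProduct.ext <| MonoidAlgebra.lhom_ext' fun x => LinearMap.ext_ring <| LinearMap.ext (h x)

theorem permTensor_hom_ext {φ ψ : permTensor X B ⟶ A}
    (h : ∀ x b, φ.hom (permTensorSingle x b) = ψ.hom (permTensorSingle x b)) : φ = ψ :=
  Rep.hom_ext (Representation.IntertwiningMap.ext (permTensor_linearMap_ext h))

/-- The linear map on `k[X] ⊗ B` given by `x ⊗ b ↦ φ x b`. -/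
def permTensorLift (φ : X → B →ₗ[k] M) : permTensor X B →ₗ[k] M :=
  TensorProduct.lift
    (Finsupp.linearCombination k φ ∘ₗ (MonoidAlgebra.coeffLinearEquiv k).toLinearMap)

@[simp]
theorem permTensorLift_single (φ : X → B →ₗ[k] M) (x : X) (b : B) :
    permTensorLift φ (permTensorSingle x b) = φ x b := by
  simp [permTensorLift, permTensorSingle]

/-- The morphism on `k[X] ⊗ B` given by `x ⊗ b ↦ φ x b`, for an equivariant family `φ`. -/
def permTensorDesc (φ : X → B →ₗ[k] A) (h : ∀ g x b, φ (g • x) (B.ρ g b) = A.ρ g (φ x b)) :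
    permTensor X B ⟶ A :=
  homMk (permTensorLift φ) fun g a => by
    have hcomp : permTensorLift φ ∘ₗ (permTensor X B).ρ g = A.ρ g ∘ₗ permTensorLift φ :=
      permTensor_linearMap_ext fun x b => by
        simp only [LinearMap.comp_apply, permTensor_ρ_single, permTensorLift_single, h]
    exact LinearMap.congr_fun hcomp a

@[simp]
theorem permTensorDesc_single (φ : X → B →ₗ[k] A)
    (h : ∀ g x b, φ (g • x) (B.ρ g b) = A.ρ g (φ x b)) (x : X) (b : B) :
    (permTensorDesc φ h).hom (permTensorSingle x b) = φ x b :=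
  permTensorLift_single φ x b

theorem exact_iff_function_exact {S : ShortComplex (Rep.{u} k G)} :
    S.Exact ↔ Function.Exact S.f.hom S.g.hom := by
  rw [← ShortComplex.exact_map_iff_of_faithful S (forget₂ (Rep.{u} k G) (ModuleCat.{u} k)),
    ShortComplex.ShortExact.moduleCat_exact_iff_function_exact]
  rfl

theorem shortExact_map_tensorLeft_ofMulAction {S : ShortComplex (Rep.{u} k G)}
    (hS : S.ShortExact) : (S.map (tensorLeft (ofMulAction k G X))).ShortExact where
  exact := exact_iff_function_exact.2 <|
    lTensor_exact k[X] (f := S.f.hom.toLinearMap) (g := S.g.hom.toLinearMap)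
      (exact_iff_function_exact.1 hS.exact) ((Rep.epi_iff_surjective _).1 hS.epi_g)
  mono_f := (Rep.mono_iff_injective _).2 <|
    Module.Flat.lTensor_preserves_injective_linearMap (M := k[X]) (S.f.hom.toLinearMap)
      ((Rep.mono_iff_injective _).1 hS.mono_f)
  epi_g := (Rep.epi_iff_surjective _).2 <|
    LinearMap.lTensor_surjective k[X] (g := S.g.hom.toLinearMap)
      ((Rep.epi_iff_surjective _).1 hS.epi_g)

variable (X B) in
/-- The augmentation `k[X] ⊗ B ⟶ B`. -/
def permTensorSum : permTensor X B ⟶ B :=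
  permTensorDesc (fun _ => LinearMap.id) fun _ _ _ => rfl

@[simp]
theorem permTensorSum_single (x : X) (b : B) :
    (permTensorSum X B).hom (permTensorSingle x b) = b :=
  permTensorDesc_single _ _ _ _

instance [Nonempty X] : Epi (permTensorSum X B) :=
  (Rep.epi_iff_surjective _).2 fun b =>
    ⟨permTensorSingle (Classical.arbitrary X) b, permTensorSum_single _ _⟩

end permTensor

theorem contractNth_zero_cons {α : Type*} {n : ℕ} (op : α → α → α) (a : α) (σ : Fin (n + 1) → α) :
    Fin.contractNth 0 op (Fin.cons a σ : Fin (n + 2) → α) = Fin.cons (op a (σ 0)) (Fin.tail σ) := by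
  funext i
  cases i using Fin.cases with
  | zero => simp [Fin.contractNth]
  | succ i => simp [Fin.contractNth, Fin.tail]

theorem contractNth_succ_cons {α : Type*} {n : ℕ} (op : α → α → α) (a : α) (σ : Fin (n + 1) → α)
    (j : Fin (n + 1)) :
    Fin.contractNth j.succ op (Fin.cons a σ : Fin (n + 2) → α) =
      Fin.cons a (Fin.contractNth j op σ) := by
  funext i
  cases i using Fin.cases with
  | zero => simp [Fin.contractNth]
  | succ i => simp [Fin.contractNth, Fin.castSucc_succ]

/-- The contracting homotopy of the inhomogeneous chains with values in `k[G] ⊗ B`. -/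
def contractingHomotopy (B : Rep.{u} k G) (n : ℕ) :
    ((Fin n → G) →₀ permTensor G B) →ₗ[k] ((Fin (n + 1) → G) →₀ permTensor G B) :=
  Finsupp.lsum k fun σ => permTensorLift fun x =>
    Finsupp.lsingle (Fin.cons x⁻¹ σ : Fin (n + 1) → G) ∘ₗ permTensorSingle 1 ∘ₗ B.ρ x⁻¹

theorem contractingHomotopy_single {B : Rep.{u} k G} {n : ℕ} (σ : Fin n → G) (x : G) (b : B) :
    contractingHomotopy B n (Finsupp.single σ (permTensorSingle x b)) =
      Finsupp.single (Fin.cons x⁻¹ σ : Fin (n + 1) → G) (permTensorSingle 1 (B.ρ x⁻¹ b)) := by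
  rw [contractingHomotopy, Finsupp.lsum_single, permTensorLift_single]
  rfl

open groupHomology

theorem contractingHomotopy_d_single {B : Rep.{u} k G} {n : ℕ} (σ : Fin (n + 1) → G) (x : G)
    (b : B) :
    contractingHomotopy B n ((inhomogeneousChains.d (permTensor G B) n).hom
        (Finsupp.single σ (permTensorSingle x b))) =
      Finsupp.single (Fin.cons (x⁻¹ * σ 0) (Fin.tail σ) : Fin (n + 1) → G)
          (permTensorSingle 1 (B.ρ x⁻¹ b)) +
        ∑ j : Fin (n + 1), (-1 : k) ^ ((j : ℕ) + 1) •
          Finsupp.single (Fin.cons x⁻¹ (Fin.contractNth j (· * ·) σ) : Fin (n + 1) → G)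
            (permTensorSingle 1 (B.ρ x⁻¹ b)) := by
  rw [inhomogeneousChains.d_single, map_add, map_sum]
  simp only [permTensor_ρ_single, map_smul, contractingHomotopy_single]
  simp [← Module.End.mul_apply, ← map_mul, Fin.tail_def]

theorem d_contractingHomotopy_single {B : Rep.{u} k G} {n : ℕ} (σ : Fin (n + 1) → G) (x : G)
    (b : B) :
    (inhomogeneousChains.d (permTensor G B) (n + 1)).hom
        (contractingHomotopy B (n + 1) (Finsupp.single σ (permTensorSingle x b))) =
      Finsupp.single σ (permTensorSingle x b) -
        contractingHomotopy B n ((inhomogeneousChains.d (permTensor G B) n).hom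
          (Finsupp.single σ (permTensorSingle x b))) := by
  rw [contractingHomotopy_d_single, contractingHomotopy_single, inhomogeneousChains.d_single,
    Fin.sum_univ_succ]
  simp only [permTensor_ρ_single, contractNth_zero_cons, contractNth_succ_cons, Fin.cons_zero,
    Fin.cons_succ, Fin.val_zero, Fin.val_succ, pow_succ _ (_ + 1), zero_add, pow_one,
    mul_neg, mul_one, neg_smul, one_smul, Finset.sum_neg_distrib, inv_inv, smul_eq_mul,
    Representation.self_inv_apply]
  abel

theorem d_contractingHomotopy {B : Rep.{u} k G} {n : ℕ}
    (z : (Fin (n + 1) → G) →₀ permTensor G B) :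
    (inhomogeneousChains.d (permTensor G B) (n + 1)).hom (contractingHomotopy B (n + 1) z) =
      z - contractingHomotopy B n ((inhomogeneousChains.d (permTensor G B) n).hom z) := by
  have key : (inhomogeneousChains.d (permTensor G B) (n + 1)).hom ∘ₗ contractingHomotopy B (n + 1) =
      LinearMap.id -
        contractingHomotopy B n ∘ₗ (inhomogeneousChains.d (permTensor G B) n).hom :=
    Finsupp.lhom_ext' fun σ => permTensor_linearMap_ext fun x b =>
      d_contractingHomotopy_single σ x b
  exact LinearMap.congr_fun key z

theorem isZero_homology_succ_of_exact (C : ChainComplex (ModuleCat.{u} k) ℕ) (i : ℕ)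
    (h : ∀ x : C.X (i + 1), C.d (i + 1) i x = 0 → ∃ y : C.X (i + 2), C.d (i + 2) (i + 1) y = x) :
    Limits.IsZero (C.homology (i + 1)) := by
  rw [← HomologicalComplex.exactAt_iff_isZero_homology,
    HomologicalComplex.exactAt_iff' C (i + 2) (i + 1) i (by simp) (by simp),
    ShortComplex.moduleCat_exact_iff]
  exact h

theorem isZero_groupHomology_succ_permTensor (B : Rep.{u} k G) (n : ℕ) :
    Limits.IsZero (groupHomology (permTensor G B) (n + 1)) := by
  refine isZero_homology_succ_of_exact _ _ fun z hz => ⟨contractingHomotopy B (n + 1) z, ?_⟩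
  rw [inhomogeneousChains.d_def] at hz ⊢
  refine (d_contractingHomotopy z).trans ?_
  rw [show (inhomogeneousChains.d (permTensor G B) n).hom z = 0 from hz, map_zero, sub_zero]

/-- A representation is relatively projective if it is a direct summand of an induced
representation `k[G] ⊗ B`; it is then already a direct summand of `k[G] ⊗ A`. -/
def IsRelativelyProjective (A : Rep.{u} k G) : Prop :=
  IsSplitEpi (permTensorSum G A)

theorem IsRelativelyProjective.isZero_groupHomology_succ {A : Rep.{u} k G}
    (hA : IsRelativelyProjective A) (n : ℕ) : Limits.IsZero (groupHomology A (n + 1)) := by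
  have : IsSplitEpi (permTensorSum G A) := hA
  let F := groupHomology.functor k G (n + 1)
  have hzero : Limits.IsZero (F.obj (permTensor G A)) := isZero_groupHomology_succ_permTensor A n
  have hA' : Limits.IsZero (F.obj A) := hzero.of_epi (F.map (permTensorSum G A))
  exact hA'

/-- The exchange isomorphism of `k[X] ⊗ (k[Y] ⊗ B)` with `k[Y] ⊗ (k[X] ⊗ B)`. -/
def permTensorSwap (X Y : Type u) [MulAction G X] [MulAction G Y] (B : Rep.{u} k G) :
    permTensor X (permTensor Y B) ⟶ permTensor Y (permTensor X B) :=
  (α_ _ _ _).inv ≫ (β_ _ _).hom ▷ B ≫ (α_ _ _ _).hom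

theorem permTensorSwap_comp_sum (X Y : Type u) [MulAction G X] [MulAction G Y] (B : Rep.{u} k G) :
    permTensorSwap X Y B ≫ permTensorSum Y (permTensor X B) =
      ofMulAction k G X ◁ permTensorSum Y B := by
  refine permTensor_hom_ext fun x c => ?_
  let S : permTensor Y B →ₗ[k] permTensor X B :=
    (permTensorSwap X Y B ≫ permTensorSum Y (permTensor X B)).hom.toLinearMap ∘ₗ permTensorSingle x
  have hS : S = permTensorSingle x ∘ₗ (permTensorSum Y B).hom.toLinearMap :=
    permTensor_linearMap_ext fun y b =>
      (permTensorSum_single y (permTensorSingle x b)).trans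
        (congrArg (permTensorSingle x) (permTensorSum_single y b)).symm
  exact LinearMap.congr_fun hS c

theorem isRelativelyProjective_permTensor {A : Rep.{u} k G} (hA : IsRelativelyProjective A)
    (X : Type u) [MulAction G X] : IsRelativelyProjective (permTensor X A) := by
  obtain ⟨⟨s⟩⟩ := hA
  refine ⟨⟨ofMulAction k G X ◁ s.section_ ≫ permTensorSwap X G A, ?_⟩⟩
  rw [Category.assoc, permTensorSwap_comp_sum, ← MonoidalCategory.whiskerLeft_comp, s.id,
    MonoidalCategory.whiskerLeft_id]

theorem isRelativelyProjective_res_permTensor (f : H →* G) {X : Type u} [MulAction G X]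
    (c : X → H) (hc : ∀ h x, c (f h • x) = h * c x) (B : Rep.{u} k G) :
    IsRelativelyProjective (res f (permTensor X B)) := by
  let A := res f (permTensor X B)
  let single (x : X) : B →ₗ[k] A := permTensorSingle x
  have hsingle (h : H) (x : X) (b : B) : A.ρ h (single x b) = single (f h • x) (B.ρ (f h) b) :=
    permTensor_ρ_single (f h) x b
  let s : A →ₗ[k] permTensor H A :=
    permTensorLift (B := B) fun x => permTensorSingle (c x) ∘ₗ single x
  have s_single (x : X) (b : B) : s (single x b) = permTensorSingle (c x) (single x b) :=
    permTensorLift_single _ x b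
  have hs (h : H) : s ∘ₗ A.ρ h = (permTensor H A).ρ h ∘ₗ s :=
    permTensor_linearMap_ext (B := B) fun x b => by
      change s (A.ρ h (single x b)) = (permTensor H A).ρ h (s (single x b))
      rw [hsingle, s_single, s_single, permTensor_ρ_single, hsingle, hc, smul_eq_mul]
  have hsum : (permTensorSum H A).hom.toLinearMap ∘ₗ s = LinearMap.id :=
    permTensor_linearMap_ext (B := B) fun x b => by
      change (permTensorSum H A).hom (s (single x b)) = single x b
      rw [s_single, permTensorSum_single]
  exact ⟨⟨homMk s fun h => LinearMap.congr_fun (hs h), hom_ext_apply (LinearMap.congr_fun hsum)⟩⟩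

theorem exists_equivariant_retraction {f : H →* G} (hf : Function.Injective f) :
    ∃ c : G → H, ∀ h x, c (f h • x) = h * c x := by
  let r (g : G) : G := (Quotient.mk (QuotientGroup.rightRel f.range) g).out
  have hr (g : G) : ∃ h, f h = g * (r g)⁻¹ :=
    MonoidHom.mem_range.1 <| QuotientGroup.rightRel_apply.1 <|
      Quotient.exact (Quotient.out_eq (Quotient.mk (QuotientGroup.rightRel f.range) g))
  choose c hc using hr
  refine ⟨c, fun h x => hf ?_⟩
  have hrx : r (f h * x) = r x :=
    congrArg Quotient.out (Quotient.sound (QuotientGroup.rightRel_apply.2 ⟨h⁻¹, by simp⟩))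
  rw [map_mul, hc, hc, smul_eq_mul, hrx, mul_assoc]

theorem H0π_ρ_apply (A : Rep.{u} k G) (g : G) (a : A) : H0π A (A.ρ g a) = H0π A a := by
  rw [← coinvariantsMk_comp_H0Iso_inv]
  exact congrArg (H0Iso A).inv (Representation.Coinvariants.mk_self_apply A.ρ g a)

theorem map_H0π_apply {A : Rep.{u} k H} {B : Rep.{u} k G} (f : H →* G) (φ : A ⟶ res f B) (a : A) :
    map f φ 0 (H0π A a) = H0π B (φ.hom a) :=
  congrArg (fun ψ => ψ.hom a) (H0π_comp_map f φ)

section DimensionShifting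

variable {f : H →* G} {S : ShortComplex (Rep.{u} k H)} {T : ShortComplex (Rep.{u} k G)}

theorem shortExact_kernel {A B : Rep.{u} k G} (p : A ⟶ B) [Epi p] :
    (ShortComplex.mk (Limits.kernel.ι p) p (Limits.kernel.condition p)).ShortExact where
  exact := ShortComplex.exact_kernel p
  mono_f := inferInstance
  epi_g := ‹_›

/-- The short exact sequence `0 ⟶ K ⟶ k[G] ⊗ B ⟶ B ⟶ 0`, whose middle term is acyclic. -/
abbrev dimensionShift (B : Rep.{u} k G) : ShortComplex (Rep.{u} k G) :=
  .mk _ _ (Limits.kernel.condition (permTensorSum G B))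

/-- The map of short complexes of inhomogeneous chains induced by a homomorphism of groups and a
map of coefficients. -/
def chainsMapShortComplex (φ : S ⟶ T.map (resFunctor f)) :
    S.map (chainsFunctor k H) ⟶ T.map (chainsFunctor k G) where
  τ₁ := chainsMap f φ.τ₁
  τ₂ := chainsMap f φ.τ₂
  τ₃ := chainsMap f φ.τ₃
  comm₁₂ := (chainsMap_comp f (.id G) φ.τ₁ T.f).symm.trans <|
    (chainsMap_congr rfl (congrArg (fun ψ => ψ.hom.toLinearMap) φ.comm₁₂)).trans
      (chainsMap_comp (.id H) f S.f φ.τ₂)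
  comm₂₃ := (chainsMap_comp f (.id G) φ.τ₂ T.g).symm.trans <|
    (chainsMap_congr rfl (congrArg (fun ψ => ψ.hom.toLinearMap) φ.comm₂₃)).trans
      (chainsMap_comp (.id H) f S.g φ.τ₃)

theorem δ_naturality (hS : S.ShortExact) (hT : T.ShortExact) (φ : S ⟶ T.map (resFunctor f))
    (n : ℕ) :
    δ hS (n + 1) n rfl ≫ map f φ.τ₁ n = map f φ.τ₃ (n + 1) ≫ δ hT (n + 1) n rfl :=
  HomologicalComplex.HomologySequence.δ_naturality (chainsMapShortComplex φ)
    (map_chainsFunctor_shortExact hS) (map_chainsFunctor_shortExact hT) (n + 1) n rfl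

theorem isIso_map_succ_τ₃ (hS : S.ShortExact) (hT : T.ShortExact) (φ : S ⟶ T.map (resFunctor f))
    (n : ℕ) (hS₂ : Limits.IsZero (groupHomology S.X₂ (n + 1)))
    (hT₂ : Limits.IsZero (groupHomology T.X₂ (n + 1))) (h₁ : IsIso (map f φ.τ₁ n))
    (h₂ : Mono (map f φ.τ₂ n)) : IsIso (map f φ.τ₃ (n + 1)) := by
  have : Mono (δ hS (n + 1) n rfl ≫ map f φ.τ₁ n) :=
    have := mono_δ_of_isZero hS n hS₂
    mono_comp _ _
  have hmono : Mono (map f φ.τ₃ (n + 1)) := mono_of_mono_fac (δ_naturality hS hT φ n).symm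
  have hepi : Epi (map f φ.τ₃ (n + 1)) := by
    refine HomologicalComplex.HomologySequence.epi_homologyMap_τ₃ (chainsMapShortComplex φ)
      (map_chainsFunctor_shortExact hS) (map_chainsFunctor_shortExact hT) (n + 1)
      (hT₂.epi _) (fun j hj => ?_) (fun j hj => ?_)
    all_goals obtain rfl : j = n := by simpa using hj
    · exact inferInstanceAs (Epi (map f φ.τ₁ j))
    · exact h₂
  exact isIso_of_mono_of_epi _

theorem isZero_groupHomology_succ_res_dimensionShift_X₂ (hf : Function.Injective f)
    (B : Rep.{u} k G) (n : ℕ) :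
    Limits.IsZero (groupHomology (res f (dimensionShift B).X₂) (n + 1)) := by
  obtain ⟨c, hc⟩ := exists_equivariant_retraction hf
  exact (isRelativelyProjective_res_permTensor f c hc B).isZero_groupHomology_succ n

end DimensionShifting

section Conjugation

/-- The action of `g` on `A`, as a morphism covering the conjugation by `g`. -/
def conjHom (g : G) (A : Rep.{u} k G) : A ⟶ res (MulAut.conj g).toMonoidHom A :=
  homMk (B := res (MulAut.conj g).toMonoidHom A) (A.ρ g) fun h a => by
    simp [← Module.End.mul_apply, ← map_mul]

theorem δ_comp_map_conjHom (g : G) {S : ShortComplex (Rep.{u} k G)} (hS : S.ShortExact) (n : ℕ) :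
    δ hS (n + 1) n rfl ≫ map (MulAut.conj g).toMonoidHom (conjHom g S.X₁) n =
      map (MulAut.conj g).toMonoidHom (conjHom g S.X₃) (n + 1) ≫ δ hS (n + 1) n rfl :=
  δ_naturality hS hS (f := (MulAut.conj g).toMonoidHom)
    { τ₁ := conjHom g S.X₁
      τ₂ := conjHom g S.X₂
      τ₃ := conjHom g S.X₃
      comm₁₂ := hom_ext_apply fun a => hom_comm_apply S.f g a
      comm₂₃ := hom_ext_apply fun a => hom_comm_apply S.g g a } n

theorem map_conj_eq_id (g : G) (A : Rep.{u} k G) (n : ℕ) :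
    map (MulAut.conj g).toMonoidHom (conjHom g A) n = 𝟙 _ := by
  induction n generalizing A with
  | zero =>
    ext x
    induction x using H0_induction_on with
    | h a => exact (map_H0π_apply _ _ a).trans (H0π_ρ_apply A g a)
  | succ n ih =>
    have hS : (dimensionShift A).ShortExact := shortExact_kernel (permTensorSum G A)
    have := mono_δ_of_isZero hS n (isZero_groupHomology_succ_permTensor A n)
    rw [← cancel_mono (δ hS (n + 1) n rfl), Category.id_comp]
    refine (δ_comp_map_conjHom g hS n).symm.trans ?_
    rw [ih]
    exact Category.comp_id _

end Conjugation

section Shapiro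

variable {X : Type u} [MulAction G X] {f : H →* G} {x₀ : X}

/-- The map `b ↦ x₀ ⊗ b` covering the inclusion of the stabilizer of `x₀`. -/
def stabilizerHom (hx₀ : MulAction.stabilizer G x₀ = f.range) (B : Rep.{u} k G) :
    res f B ⟶ res f (permTensor X B) :=
  homMk (A := res f B) (B := res f (permTensor X B)) (permTensorSingle (B := B) x₀) fun h b => by
    have hfix : f h • x₀ = x₀ := MulAction.mem_stabilizer_iff.1 (hx₀ ▸ ⟨h, rfl⟩)
    exact (congrArg (permTensorSingle · _) hfix).symm.trans
      (permTensor_ρ_single (f h) x₀ b).symm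

/-- The reason why the homology of the stabilizer does not depend on the choice of
a translating element. -/
theorem coinvariantsMk_ρ_inv_eq_of_smul_eq (hx₀ : MulAction.stabilizer G x₀ = f.range)
    (B : Rep.{u} k G) {g g' : G} (hg : g • x₀ = g' • x₀) (b : B) :
    Representation.Coinvariants.mk (res f B).ρ (B.ρ g⁻¹ b) =
      Representation.Coinvariants.mk (res f B).ρ (B.ρ g'⁻¹ b) := by
  obtain ⟨h, hh⟩ : g'⁻¹ * g ∈ f.range := by
    rw [← hx₀, MulAction.mem_stabilizer_iff, mul_smul, hg, inv_smul_smul]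
  rw [← Representation.Coinvariants.mk_self_apply (res f B).ρ h (B.ρ g⁻¹ b)]
  refine congrArg (Representation.Coinvariants.mk (res f B).ρ) ?_
  change B.ρ (f h) (B.ρ g⁻¹ b) = _
  rw [hh, ← Module.End.mul_apply, ← map_mul, mul_inv_cancel_right]

variable [MulAction.IsPretransitive G X]

theorem map_stabilizerHom_zero_surjective (hx₀ : MulAction.stabilizer G x₀ = f.range)
    (B : Rep.{u} k G) : Function.Surjective (map f (stabilizerHom hx₀ B) 0) := by
  let m : groupHomology (res f B) 0 →ₗ[k] groupHomology (permTensor X B) 0 :=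
    (map f (stabilizerHom hx₀ B) 0).hom
  let π : permTensor X B →ₗ[k] groupHomology (permTensor X B) 0 := (H0π (permTensor X B)).hom
  have hsingle (x : X) (b : B) : π (permTensorSingle x b) ∈ LinearMap.range m := by
    obtain ⟨g, rfl⟩ := MulAction.exists_smul_eq G x₀ x
    refine ⟨H0π (res f B) (B.ρ g⁻¹ b), (map_H0π_apply _ _ _).trans ?_⟩
    refine (H0π_ρ_apply _ g _).symm.trans (congrArg (H0π (permTensor X B)) ?_)
    refine (permTensor_ρ_single g x₀ _).trans ?_
    rw [Representation.self_inv_apply]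
  have hmap : (LinearMap.range m).mkQ ∘ₗ π = 0 :=
    permTensor_linearMap_ext fun x b => (Submodule.Quotient.mk_eq_zero _).2 (hsingle x b)
  intro y
  induction y using H0_induction_on with
  | h a => exact (Submodule.Quotient.mk_eq_zero _).1 (LinearMap.congr_fun hmap a)

/-- The retraction of `stabilizerHom` on coinvariants: it sends `x ⊗ b` to the class of `g⁻¹ b`
for any `g` with `g • x₀ = x`. -/
def coinvariantsRetraction (f : H →* G) (x₀ : X) (B : Rep.{u} k G) :
    permTensor X B →ₗ[k] Representation.Coinvariants (res f B).ρ :=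
  permTensorLift (B := B) fun x => (Representation.Coinvariants.mk (res f B).ρ : B →ₗ[k] _) ∘ₗ
    B.ρ (MulAction.exists_smul_eq G x₀ x).choose⁻¹

theorem coinvariantsRetraction_smul_single (hx₀ : MulAction.stabilizer G x₀ = f.range)
    (B : Rep.{u} k G) (g : G) (b : B) :
    coinvariantsRetraction f x₀ B (permTensorSingle (g • x₀) b) =
      Representation.Coinvariants.mk (res f B).ρ (B.ρ g⁻¹ b) :=
  (permTensorLift_single _ _ _).trans <|
    coinvariantsMk_ρ_inv_eq_of_smul_eq hx₀ B (MulAction.exists_smul_eq G x₀ (g • x₀)).choose_spec b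

theorem coinvariantsRetraction_comp_ρ (hx₀ : MulAction.stabilizer G x₀ = f.range)
    (B : Rep.{u} k G) (g : G) :
    coinvariantsRetraction f x₀ B ∘ₗ (permTensor X B).ρ g = coinvariantsRetraction f x₀ B := by
  refine permTensor_linearMap_ext fun x b => ?_
  obtain ⟨g', rfl⟩ := MulAction.exists_smul_eq G x₀ x
  rw [LinearMap.comp_apply, permTensor_ρ_single, ← mul_smul,
    coinvariantsRetraction_smul_single hx₀, coinvariantsRetraction_smul_single hx₀, mul_inv_rev,
    map_mul, Module.End.mul_apply, Representation.inv_self_apply]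

theorem map_stabilizerHom_zero_injective (hx₀ : MulAction.stabilizer G x₀ = f.range)
    (B : Rep.{u} k G) : Function.Injective (map f (stabilizerHom hx₀ B) 0) := by
  let L := Representation.Coinvariants.lift _ _ (coinvariantsRetraction_comp_ρ hx₀ B)
  refine Function.Injective.of_comp
    (f := fun y => (H0Iso (res f B)).inv (L ((H0Iso (permTensor X B)).hom y))) ?_
  refine Function.LeftInverse.injective (g := id) fun y => ?_
  induction y using H0_induction_on with
  | h b =>
    have hb : coinvariantsRetraction f x₀ B (permTensorSingle x₀ b) =
        Representation.Coinvariants.mk (res f B).ρ b := by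
      simpa using coinvariantsRetraction_smul_single hx₀ B 1 b
    have hL : L ((H0Iso (permTensor X B)).hom (H0π (permTensor X B) (permTensorSingle x₀ b))) =
        Representation.Coinvariants.mk (res f B).ρ b := by
      rw [H0π_comp_H0Iso_hom_apply]
      exact hb
    change (H0Iso (res f B)).inv (L ((H0Iso (permTensor X B)).hom
      (map f (stabilizerHom hx₀ B) 0 (H0π (res f B) b)))) = H0π (res f B) b
    rw [map_H0π_apply]
    refine (congrArg (H0Iso (res f B)).inv hL).trans ?_
    exact congrArg (fun ψ => ψ.hom b) (coinvariantsMk_comp_H0Iso_inv (res f B))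

/-- The map of short complexes given by `stabilizerHom` in each term. -/
def stabilizerShortComplexHom (hx₀ : MulAction.stabilizer G x₀ = f.range)
    (S : ShortComplex (Rep.{u} k G)) :
    S.map (resFunctor f) ⟶ (S.map (tensorLeft (ofMulAction k G X))).map (resFunctor f) where
  τ₁ := stabilizerHom hx₀ S.X₁
  τ₂ := stabilizerHom hx₀ S.X₂
  τ₃ := stabilizerHom hx₀ S.X₃
  comm₁₂ := rfl
  comm₂₃ := rfl

/-- Shapiro's lemma, by dimension shifting along `k[G] ⊗ B ⟶ B`. -/
theorem isIso_map_stabilizerHom (hf : Function.Injective f)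
    (hx₀ : MulAction.stabilizer G x₀ = f.range) (B : Rep.{u} k G) (n : ℕ) :
    IsIso (map f (stabilizerHom hx₀ B) n) := by
  induction n generalizing B with
  | zero =>
    exact (ConcreteCategory.isIso_iff_bijective _).2
      ⟨map_stabilizerHom_zero_injective hx₀ B, map_stabilizerHom_zero_surjective hx₀ B⟩
  | succ n ih =>
    have hS : (dimensionShift B).ShortExact := shortExact_kernel (permTensorSum G B)
    have hmono : Mono (map f (stabilizerHom hx₀ (permTensor G B)) n) :=
      have := ih (permTensor G B)
      inferInstance
    exact isIso_map_succ_τ₃ ((shortExact_res f).2 hS) (shortExact_map_tensorLeft_ofMulAction hS)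
      (stabilizerShortComplexHom hx₀ (dimensionShift B)) n
      (isZero_groupHomology_succ_res_dimensionShift_X₂ hf B n)
      ((isRelativelyProjective_permTensor
        (isRelativelyProjective_res_permTensor (.id G) id (fun _ _ => rfl) B)
          X).isZero_groupHomology_succ n) (ih _) hmono

end Shapiro

section AlgebraicStability

theorem shortExact_kernel_lift {C : Type*} [Category C] [Abelian C] {X Y Z : C}
    (f : X ⟶ Y) (g : Y ⟶ Z) (w : f ≫ g = 0) [Epi (Limits.kernel.lift g f w)] :
    (ShortComplex.mk (Limits.kernel.ι f) (Limits.kernel.lift g f w)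
      (by rw [← cancel_mono (Limits.kernel.ι g)]; simp)).ShortExact where
  exact := by
    let φ : ShortComplex.mk (Limits.kernel.ι f) (Limits.kernel.lift g f w)
        (by rw [← cancel_mono (Limits.kernel.ι g)]; simp) ⟶
          ShortComplex.mk (Limits.kernel.ι f) f (Limits.kernel.condition f) :=
      { τ₁ := 𝟙 _, τ₂ := 𝟙 _, τ₃ := Limits.kernel.ι g }
    have : Epi φ.τ₁ := inferInstanceAs (Epi (𝟙 _))
    have : IsIso φ.τ₂ := inferInstanceAs (IsIso (𝟙 _))
    have : Mono φ.τ₃ := inferInstanceAs (Mono (Limits.kernel.ι g))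
    exact (ShortComplex.exact_iff_of_epi_of_isIso_of_mono φ).2 (ShortComplex.exact_kernel f)
  mono_f := inferInstance
  epi_g := ‹_›

/-- The map on group homology induced by a morphism of coefficients. -/
abbrev mapCoeff {A B : Rep.{u} k G} (φ : A ⟶ B) (n : ℕ) : groupHomology A n ⟶ groupHomology B n :=
  map (.id G) φ n

theorem epi_mapCoeff_succ_of_mono {S : ShortComplex (Rep.{u} k G)} (hS : S.ShortExact) (q : ℕ)
    (h : Mono (mapCoeff S.f q)) : Epi (mapCoeff S.g (q + 1)) := by
  have hδ : δ hS (q + 1) q rfl = 0 := by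
    rw [← cancel_mono (mapCoeff S.f q), Limits.zero_comp]
    exact (mapShortComplex₁ hS (i := q + 1) (j := q) rfl).zero
  exact (mapShortComplex₃_exact hS (i := q + 1) (j := q) rfl).epi_f hδ

theorem mono_mapCoeff_of_eq_zero {S : ShortComplex (Rep.{u} k G)} (hS : S.ShortExact) (q : ℕ)
    (h : mapCoeff S.f q = 0) : Mono (mapCoeff S.g q) :=
  (mapShortComplex₂_exact hS q).mono_g h

variable {X : ℕ → Rep.{u} k G} {d : ∀ p, X (p + 1) ⟶ X p} (hd : ∀ p, d (p + 1) ≫ d p = 0)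

/-- The differential of the complex `X`, with values in the cycles. -/
def toKernel (p : ℕ) : X (p + 2) ⟶ Limits.kernel (d p) :=
  Limits.kernel.lift _ (d (p + 1)) (hd p)

theorem mapCoeff_toKernel_comp_kernelι (p q : ℕ) :
    mapCoeff (toKernel hd p) q ≫ mapCoeff (Limits.kernel.ι (d p)) q =
      mapCoeff (d (p + 1)) q := by
  rw [← map_id_comp, toKernel, Limits.kernel.lift_ι]

theorem mapCoeff_comp_toKernel (p q : ℕ) :
    mapCoeff (d (p + 2)) q ≫ mapCoeff (toKernel hd p) q = 0 := by
  have hzero : d (p + 2) ≫ toKernel hd p = 0 := by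
    rw [← cancel_mono (Limits.kernel.ι (d p)), Category.assoc, toKernel, Limits.kernel.lift_ι,
      hd, Limits.zero_comp]
  rw [← map_id_comp, hzero]
  exact (groupHomology.functor k G q).map_zero _ _

theorem epi_mapCoeff_toKernel_succ {p q : ℕ} [Epi (toKernel hd p)]
    (h : Mono (mapCoeff (Limits.kernel.ι (d (p + 1))) q)) :
    Epi (mapCoeff (toKernel hd p) (q + 1)) :=
  have : Epi (Limits.kernel.lift _ (d (p + 1)) (hd p)) := ‹Epi (toKernel hd p)›
  epi_mapCoeff_succ_of_mono (shortExact_kernel_lift _ _ (hd p)) q h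

theorem isZero_groupHomology_kernel {p q : ℕ} (hepi : Epi (mapCoeff (toKernel hd p) q))
    (hiso : IsIso (mapCoeff (d (p + 2)) q)) :
    Limits.IsZero (groupHomology (Limits.kernel (d p)) q) := by
  refine Limits.IsZero.of_epi_eq_zero (mapCoeff (toKernel hd p) q) ?_
  rw [← cancel_epi (mapCoeff (d (p + 2)) q), mapCoeff_comp_toKernel, Limits.comp_zero]

theorem mono_mapCoeff_kernelι {p q : ℕ} (hepi : Epi (mapCoeff (toKernel hd p) q))
    (hiso : IsIso (mapCoeff (d (p + 1)) q)) :
    Mono (mapCoeff (Limits.kernel.ι (d p)) q) := by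
  have hcomp := mapCoeff_toKernel_comp_kernelι hd p q
  have : Mono (mapCoeff (toKernel hd p) q) := mono_of_mono_fac hcomp
  have : IsIso (mapCoeff (toKernel hd p) q) := isIso_of_mono_of_epi _
  rw [← (IsIso.inv_comp_eq _).2 hcomp.symm]
  infer_instance

variable {n r : ℕ} (hexact : ∀ p, p + 1 < n → Epi (toKernel hd p))
  (hiso : ∀ p q, Even p → q ≤ r → 2 * q + p < n → IsIso (mapCoeff (d p) q))

include hexact hiso

theorem epi_mapCoeff_toKernel (q : ℕ) (hq : q ≤ r + 1) (p : ℕ) (hp : p + 1 < n)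
    (hn : 2 * q + p + 1 < n ∨ Even p ∧ 2 * q + p + 1 ≤ n) :
    Epi (mapCoeff (toKernel hd p) q) := by
  have := hexact p hp
  induction q generalizing p with
  | zero => exact epi_map_0_of_epi _
  | succ q ih =>
    refine epi_mapCoeff_toKernel_succ hd ?_
    have hexact' := hexact (p + 1) (by omega)
    by_cases hpe : Even p
    · exact mono_mapCoeff_kernelι hd (ih (by omega) (p + 1) (by omega) (.inl (by omega)) hexact')
        (hiso (p + 2) q (hpe.add even_two) (by omega) (by omega))
    · have hn' := hn.resolve_right fun h => hpe h.1
      have hpe' : Even (p + 1) := Nat.even_add_one.2 hpe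
      have hzero := isZero_groupHomology_kernel hd
        (ih (by omega) (p + 1) (by omega) (.inr ⟨hpe', by omega⟩) hexact')
        (hiso (p + 3) q (hpe'.add even_two) (by omega) (by omega))
      exact hzero.mono _

theorem isIso_mapCoeff_succ_of_acyclic [Epi (d 0)] (hn : 2 * (r + 1) < n)
    (hzero : mapCoeff (d 1) (r + 1) = 0) : IsIso (mapCoeff (d 0) (r + 1)) := by
  have hS := shortExact_kernel (d 0)
  have hepi : Epi (mapCoeff (d 0) (r + 1)) := by
    have hker := isZero_groupHomology_kernel hd
      (epi_mapCoeff_toKernel hd hexact hiso r (by omega) 0 (by omega) (.inl (by omega)))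
      (hiso 2 r even_two le_rfl (by omega))
    exact epi_mapCoeff_succ_of_mono hS r (hker.mono _)
  have hmono : Mono (mapCoeff (d 0) (r + 1)) := by
    have :=
      epi_mapCoeff_toKernel hd hexact hiso (r + 1) le_rfl 0 (by omega) (.inr ⟨.zero, by omega⟩)
    refine mono_mapCoeff_of_eq_zero hS (r + 1) ?_
    exact Limits.zero_of_epi_comp _ ((mapCoeff_toKernel_comp_kernelι hd 0 (r + 1)).trans hzero)
  exact isIso_of_mono_of_epi _

end AlgebraicStability

namespace InjectiveWord

open Finset

variable {R α : Type*} [CommRing R]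

section Chains

/-- The map `w ↦ b w` on the free module on the words in `α`. -/
def prepend (b : α) : (List α →₀ R) →ₗ[R] (List α →₀ R) :=
  Finsupp.lmapDomain R R (List.cons b)

@[simp]
theorem prepend_single (b : α) (w : List α) (r : R) :
    prepend b (Finsupp.single w r) = Finsupp.single (b :: w) r :=
  Finsupp.mapDomain_single

variable (R) in
/-- The alternating sum of the words obtained from `w` by deleting one letter. -/
def wordBoundary : List α → (List α →₀ R)
  | [] => 0
  | b :: w => Finsupp.single w 1 - prepend b (wordBoundary w)

/-- The boundary operator on the free module on all words. The empty word sits in the lowest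
degree, and its boundary is zero. -/
def chainBoundary : (List α →₀ R) →ₗ[R] (List α →₀ R) :=
  Finsupp.linearCombination R (wordBoundary R)

@[simp]
theorem chainBoundary_single_one (w : List α) :
    chainBoundary (Finsupp.single w (1 : R)) = wordBoundary R w := by
  simp [chainBoundary]

theorem chainBoundary_prepend (b : α) (z : List α →₀ R) :
    chainBoundary (prepend b z) = z - prepend b (chainBoundary z) := by
  have key : chainBoundary ∘ₗ prepend b =
      LinearMap.id - prepend b ∘ₗ (chainBoundary : (List α →₀ R) →ₗ[R] _) :=
    Finsupp.lhom_ext' fun w => LinearMap.ext_ring (by simp [wordBoundary])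
  exact LinearMap.congr_fun key z

theorem chainBoundary_chainBoundary (z : List α →₀ R) :
    chainBoundary (chainBoundary z) = 0 := by
  have key : chainBoundary ∘ₗ chainBoundary = (0 : (List α →₀ R) →ₗ[R] _) := by
    refine Finsupp.lhom_ext' fun w => LinearMap.ext_ring ?_
    induction w with
    | nil => simp [wordBoundary]
    | cons b w ih =>
      replace ih : chainBoundary (wordBoundary R w) = 0 := by simpa using ih
      simp [wordBoundary, chainBoundary_prepend, ih]
  exact LinearMap.congr_fun key z

/-- The sum of the `r w` over the terms `r (b w)` of a chain. -/
def tailPart (b : α) : (List α →₀ R) →ₗ[R] (List α →₀ R) :=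
  Finsupp.lcomapDomain (List.cons b) List.cons_injective

theorem mem_support_of_mem_support_tailPart {b : α} {z : List α →₀ R} {w : List α}
    (hw : w ∈ (tailPart b z).support) : b :: w ∈ z.support :=
  Finsupp.mem_support_iff.2 (Finsupp.mem_support_iff.1 hw :)

theorem tailPart_prepend_self (b : α) (z : List α →₀ R) : tailPart b (prepend b z) = z :=
  Finsupp.comapDomain_mapDomain _ List.cons_injective z

theorem tailPart_single_of_notMem_range {b : α} {w : List α} (hw : w ∉ Set.range (List.cons b))
    (r : R) : tailPart b (Finsupp.single w r) = 0 :=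
  Finsupp.ext fun v => Finsupp.single_eq_of_ne fun h => hw ⟨v, h⟩

theorem tailPart_prepend_of_ne {b c : α} (h : c ≠ b) (z : List α →₀ R) :
    tailPart b (prepend c z) = 0 :=
  Finsupp.ext fun _ => Finsupp.mapDomain_of_notMem_range _ _ (by simp [h])

theorem tailPart_chainBoundary (b : α) (z : List α →₀ R) :
    tailPart b (chainBoundary z) =
      tailPart b (Finsupp.lmapDomain R R List.tail z) - chainBoundary (tailPart b z) := by
  have key : tailPart b ∘ₗ chainBoundary =
      tailPart b ∘ₗ Finsupp.lmapDomain R R List.tail - chainBoundary ∘ₗ tailPart b := by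
    refine Finsupp.lhom_ext' fun w => LinearMap.ext_ring ?_
    simp only [LinearMap.comp_apply, LinearMap.sub_apply, Finsupp.lsingle_apply,
      Finsupp.lmapDomain_apply, Finsupp.mapDomain_single, chainBoundary_single_one]
    cases w with
    | nil => simp [wordBoundary, tailPart_single_of_notMem_range]
    | cons c w =>
      rw [wordBoundary, map_sub, ← prepend_single c, List.tail_cons]
      obtain rfl | h := eq_or_ne c b
      · rw [tailPart_prepend_self, tailPart_prepend_self, chainBoundary_single_one]
      · rw [tailPart_prepend_of_ne h, tailPart_prepend_of_ne h, map_zero]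
  exact LinearMap.congr_fun key z

end Chains

section Acyclicity

variable (R) in
/-- The chains on the injective words of length `p` with letters in `s`. -/
def injectiveChains (s : Finset α) (p : ℕ) : Submodule R (List α →₀ R) :=
  Finsupp.supported R R {w | w.Nodup ∧ (∀ x ∈ w, x ∈ s) ∧ w.length = p}

variable (R) in
/-- The chains on the words in which `a` either does not occur or occurs among the first `j`
letters. -/
def occursBefore (a : α) (j : ℕ) : Submodule R (List α →₀ R) :=
  Finsupp.supported R R {w | a ∈ w.take j ∨ a ∉ w}

variable {s : Finset α} {p j : ℕ} {a b : α} {z : List α →₀ R}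

theorem mapDomain_mem_supported {β γ : Type*} {f : β → γ} {S : Set β} {T : Set γ}
    (hf : Set.MapsTo f S T) {z : β →₀ R} (hz : z ∈ Finsupp.supported R R S) :
    Finsupp.mapDomain f z ∈ Finsupp.supported R R T := by
  refine Finsupp.supported_mono hf.image_subset ?_
  rw [← Finsupp.lmapDomain_supported R R f S]
  exact Submodule.mem_map_of_mem hz

theorem wordBoundary_mem_supported (w : List α) :
    wordBoundary R w ∈ Finsupp.supported R R {v | v.Sublist w ∧ v.length + 1 = w.length} := by
  induction w with
  | nil => exact zero_mem _
  | cons b w ih =>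
    refine sub_mem (Finsupp.single_mem_supported R 1 ⟨w.sublist_cons_self b, rfl⟩) ?_
    refine mapDomain_mem_supported (fun v hv => ?_) ih
    exact ⟨hv.1.cons_cons b, congrArg (· + 1) hv.2⟩

theorem chainBoundary_mem_injectiveChains (hz : z ∈ injectiveChains R s (p + 1)) :
    chainBoundary z ∈ injectiveChains R s p := by
  refine sum_mem fun w hw => Submodule.smul_mem _ _ ?_
  obtain ⟨hnd, hs, hlen⟩ := hz hw
  refine Finsupp.supported_mono ?_ (wordBoundary_mem_supported w)
  rintro v ⟨hvw, hv⟩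
  exact ⟨hnd.sublist hvw, fun x hx => hs x (hvw.subset hx), by lia⟩

theorem prepend_mem_injectiveChains [DecidableEq α] (hb : b ∈ s)
    (hz : z ∈ injectiveChains R (s.erase b) p) : prepend b z ∈ injectiveChains R s (p + 1) := by
  refine mapDomain_mem_supported (fun w hw => ?_) hz
  obtain ⟨hnd, hs, hlen⟩ := hw
  refine ⟨List.nodup_cons.2 ⟨fun h => notMem_erase b s (hs b h), hnd⟩, ?_, congrArg (· + 1) hlen⟩
  exact List.forall_mem_cons.2 ⟨hb, fun x hx => mem_of_mem_erase (hs x hx)⟩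

theorem tailPart_mem_injectiveChains [DecidableEq α] (b : α)
    (hz : z ∈ injectiveChains R s (p + 1)) : tailPart b z ∈ injectiveChains R (s.erase b) p := by
  intro w hw
  obtain ⟨hnd, hs, hlen⟩ := hz (mem_support_of_mem_support_tailPart hw)
  rw [List.nodup_cons] at hnd
  rw [List.forall_mem_cons] at hs
  refine ⟨hnd.2, fun x hx => mem_erase.2 ⟨?_, hs.2 x hx⟩, Nat.succ_injective hlen⟩
  exact ne_of_mem_of_not_mem hx hnd.1

theorem sum_prepend_tailPart (hz : z ∈ injectiveChains R s (p + 1)) :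
    ∑ b ∈ s, prepend b (tailPart b z) = z := by
  classical
  ext w
  rw [Finsupp.finsetSum_apply]
  have hz' := (Finsupp.mem_supported' R z).1 hz
  cases w with
  | nil =>
    rw [hz' [] (by simp)]
    exact sum_eq_zero fun b _ => Finsupp.mapDomain_of_notMem_range _ _ (by simp)
  | cons c w =>
    have hself : prepend c (tailPart c z) (c :: w) = z (c :: w) :=
      Finsupp.mapDomain_apply List.cons_injective _ _
    rw [← hself]
    refine sum_eq_single c (fun b _ hb => ?_) fun hc => ?_
    · exact Finsupp.mapDomain_of_notMem_range _ _ (by simp [hb])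
    · rw [hself, hz' _ fun h => hc (h.2.1 c List.mem_cons_self)]

theorem injectiveChains_erase_le_occursBefore [DecidableEq α] :
    injectiveChains R (s.erase a) p ≤ occursBefore R a j :=
  Finsupp.supported_mono fun _ hw => .inr fun h => notMem_erase a s (hw.2.1 a h)

theorem mem_injectiveChains_erase [DecidableEq α] (hz : z ∈ injectiveChains R s p)
    (hza : z ∈ occursBefore R a 0) : z ∈ injectiveChains R (s.erase a) p := by
  intro w hw
  obtain ⟨hnd, hs, hlen⟩ := hz hw
  refine ⟨hnd, fun x hx => mem_erase.2 ⟨?_, hs x hx⟩, hlen⟩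
  rintro rfl
  simpa [hx] using hza hw

theorem injectiveChains_le_occursBefore (hpj : p ≤ j) :
    injectiveChains R s p ≤ occursBefore R a j :=
  Finsupp.supported_mono fun w hw => by
    change a ∈ w.take j ∨ a ∉ w
    rw [List.take_of_length_le (hw.2.2.le.trans hpj)]
    exact em _

theorem prepend_self_mem_occursBefore (z : List α →₀ R) :
    prepend a z ∈ occursBefore R a (j + 1) :=
  mapDomain_mem_supported (S := .univ) (fun w _ => .inl (by simp)) (by simp)

theorem prepend_mem_occursBefore (hab : a ≠ b) (hz : z ∈ occursBefore R a j) :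
    prepend b z ∈ occursBefore R a (j + 1) :=
  mapDomain_mem_supported (fun w hw => by simpa [hab] using hw) hz

theorem prepend_mem_occursBefore_zero (hab : a ≠ b) (hz : z ∈ occursBefore R a 0) :
    prepend b z ∈ occursBefore R a 0 :=
  mapDomain_mem_supported (fun w hw => by simpa [hab] using hw) hz

theorem tailPart_self_eq_zero (hz : z ∈ occursBefore R a 0) : tailPart a z = 0 :=
  Finsupp.ext fun w => (Finsupp.mem_supported' R z).1 hz (a :: w) (by simp)

theorem tailPart_mem_occursBefore (hab : a ≠ b) (hz : z ∈ occursBefore R a (j + 1)) :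
    tailPart b z ∈ occursBefore R a j := by
  intro w hw
  simpa [hab] using hz (mem_support_of_mem_support_tailPart hw)

theorem mapDomain_tail_mem_occursBefore (hz : z ∈ injectiveChains R s p)
    (hza : z ∈ occursBefore R a (j + 1)) :
    Finsupp.lmapDomain R R List.tail z ∈ occursBefore R a j := by
  have hz' : z ∈ Finsupp.supported R R {w | w.Nodup ∧ (a ∈ w.take (j + 1) ∨ a ∉ w)} :=
    fun w hw => ⟨(hz hw).1, hza hw⟩
  refine mapDomain_mem_supported (fun w hw => ?_) hz'
  obtain ⟨hnd, hw⟩ := hw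
  cases w with
  | nil => exact .inr (by simp)
  | cons b w => grind

variable (R) in
/-- The acyclicity of the complex of injective words with letters in `s` in lengths below `#s`. -/
def IsAcyclicBelowTop (s : Finset α) : Prop :=
  ∀ p < #s, ∀ z ∈ injectiveChains R s p, chainBoundary z = 0 →
    ∃ y ∈ injectiveChains R s (p + 1), chainBoundary y = z

theorem exists_sub_chainBoundary_mem_occursBefore_zero [DecidableEq α] (ha : a ∈ s)
    (hs : IsAcyclicBelowTop R (s.erase a)) (hp : p + 1 < #s)
    (hz : z ∈ injectiveChains R s (p + 1)) (hza : z ∈ occursBefore R a 1)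
    (hdz : chainBoundary z ∈ occursBefore R a 0) :
    ∃ c ∈ injectiveChains R s (p + 2), c ∈ occursBefore R a 1 ∧
      z - chainBoundary c ∈ occursBefore R a 0 := by
  have hcycle : chainBoundary (tailPart a z) = 0 := by
    have h := tailPart_chainBoundary a z
    rwa [tailPart_self_eq_zero hdz, tailPart_self_eq_zero (mapDomain_tail_mem_occursBefore hz hza),
      zero_sub, zero_eq_neg] at h
  obtain ⟨y, hy, hdy⟩ := hs p (by rw [card_erase_of_mem ha]; omega) _
    (tailPart_mem_injectiveChains a hz) hcycle
  refine ⟨-prepend a y, neg_mem (prepend_mem_injectiveChains ha hy),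
    neg_mem (prepend_self_mem_occursBefore y), ?_⟩
  have hsum : z - chainBoundary (-prepend a y) =
      y + ∑ b ∈ s.erase a, prepend b (tailPart b z) := by
    nth_rw 1 [← sum_prepend_tailPart hz]
    rw [map_neg, chainBoundary_prepend, hdy, ← add_sum_erase s _ ha]
    abel
  rw [hsum]
  refine add_mem (injectiveChains_erase_le_occursBefore hy) (sum_mem fun b hb => ?_)
  have hab := (ne_of_mem_erase hb).symm
  exact prepend_mem_occursBefore_zero hab (tailPart_mem_occursBefore hab hza)

theorem sub_chainBoundary_neg_sum_prepend [DecidableEq α] (ha : a ∈ s)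
    (hz : z ∈ injectiveChains R s (p + 1)) (c : α → List α →₀ R) :
    z - chainBoundary (-∑ b ∈ s.erase a, prepend b (c b)) = prepend a (tailPart a z) +
      ∑ b ∈ s.erase a, (prepend b (tailPart b z - chainBoundary (c b)) + c b) := by
  nth_rw 1 [← sum_prepend_tailPart hz]
  rw [← add_sum_erase s _ ha, map_neg, map_sum, sub_neg_eq_add, add_assoc, ← sum_add_distrib]
  congr 1
  refine sum_congr rfl fun b _ => ?_
  rw [chainBoundary_prepend, map_sub]
  abel

theorem exists_sub_chainBoundary_mem_occursBefore (ha : a ∈ s)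
    (hs : ∀ t ⊂ s, IsAcyclicBelowTop R t) (hp : p + 1 < #s)
    (hz : z ∈ injectiveChains R s (p + 1)) (hza : z ∈ occursBefore R a (j + 1))
    (hdz : chainBoundary z ∈ occursBefore R a j) :
    ∃ c ∈ injectiveChains R s (p + 2), c ∈ occursBefore R a (j + 1) ∧
      z - chainBoundary c ∈ occursBefore R a j := by
  classical
  induction j generalizing s p z with
  | zero =>
    exact exists_sub_chainBoundary_mem_occursBefore_zero ha (hs _ (erase_ssubset ha)) hp hz hza hdz
  | succ j ih =>
    obtain _ | p := p
    · exact ⟨0, zero_mem _, zero_mem _, by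
        simpa using injectiveChains_le_occursBefore (by omega) hz⟩
    have hstep (b : α) (hb : b ∈ s.erase a) : ∃ c ∈ injectiveChains R (s.erase b) (p + 2),
        c ∈ occursBefore R a (j + 1) ∧ tailPart b z - chainBoundary c ∈ occursBefore R a j := by
      obtain ⟨hba, hbs⟩ := mem_erase.1 hb
      refine ih (mem_erase.2 ⟨hba.symm, ha⟩) (fun t ht => hs t (ht.trans (erase_ssubset hbs)))
        (by rw [card_erase_of_mem hbs]; omega) (tailPart_mem_injectiveChains b hz)
        (tailPart_mem_occursBefore hba.symm hza) ?_
      rw [← sub_eq_iff_eq_add.2 (sub_eq_iff_eq_add'.1 (tailPart_chainBoundary b z).symm)]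
      exact sub_mem
        (tailPart_mem_occursBefore hba.symm (mapDomain_tail_mem_occursBefore hz hza))
        (tailPart_mem_occursBefore hba.symm hdz)
    choose! c hc hca hdc using hstep
    refine ⟨-∑ b ∈ s.erase a, prepend b (c b), neg_mem (sum_mem fun b hb => ?_),
      neg_mem (sum_mem fun b hb => ?_), ?_⟩
    · exact prepend_mem_injectiveChains (mem_of_mem_erase hb) (hc b hb)
    · exact prepend_mem_occursBefore (ne_of_mem_erase hb).symm (hca b hb)
    rw [sub_chainBoundary_neg_sum_prepend ha hz]
    refine add_mem (prepend_self_mem_occursBefore _) (sum_mem fun b hb => add_mem ?_ (hca b hb))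
    exact prepend_mem_occursBefore (ne_of_mem_erase hb).symm (hdc b hb)

theorem isAcyclicBelowTop (s : Finset α) : IsAcyclicBelowTop R s := by
  classical
  induction s using Finset.strongInduction with
  | H s hs =>
    intro p hp z hz hdz
    obtain ⟨a, ha⟩ := card_pos.1 (by omega : 0 < #s)
    suffices h : ∀ j, z ∈ occursBefore R a j → ∃ y ∈ injectiveChains R s (p + 1),
        chainBoundary y = z from h p (injectiveChains_le_occursBefore le_rfl hz)
    intro j
    induction j generalizing z with
    | zero =>
      intro hza
      exact ⟨prepend a z, prepend_mem_injectiveChains ha (mem_injectiveChains_erase hz hza), by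
        rw [chainBoundary_prepend, hdz, map_zero, sub_zero]⟩
    | succ j ih =>
      intro hza
      obtain _ | p := p
      · exact ih z hz hdz (injectiveChains_le_occursBefore (Nat.zero_le j) hz)
      obtain ⟨c, hc, -, hzc⟩ := exists_sub_chainBoundary_mem_occursBefore ha hs hp hz hza
        (by rw [hdz]; exact zero_mem _)
      obtain ⟨y, hy, hdy⟩ := ih (z - chainBoundary c)
        (sub_mem hz (chainBoundary_mem_injectiveChains hc))
        (by rw [map_sub, hdz, chainBoundary_chainBoundary, sub_zero]) hzc
      exact ⟨y + c, add_mem hy hc, by rw [map_add, hdy, sub_add_cancel]⟩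

end Acyclicity

section Embeddings

/-- The word obtained from `x` by deleting the `i`-th letter. -/
abbrev face {p : ℕ} (i : Fin (p + 1)) (x : Fin (p + 1) ↪ α) : Fin p ↪ α :=
  (Fin.succAboveEmb i).trans x

variable (R α) in
/-- The boundary operator of the augmented complex of injective words: a word is encoded as an
injection, and the empty word spans the chains of length `0`. -/
def boundary (p : ℕ) : ((Fin (p + 1) ↪ α) →₀ R) →ₗ[R] ((Fin p ↪ α) →₀ R) :=
  ∑ i : Fin (p + 1), (-1 : ℤ) ^ (i : ℕ) • Finsupp.lmapDomain R R (face i)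

theorem boundary_single {p : ℕ} (x : Fin (p + 1) ↪ α) (r : R) :
    boundary R α p (Finsupp.single x r) =
      ∑ i : Fin (p + 1), (-1 : ℤ) ^ (i : ℕ) • Finsupp.single (face i x) r := by
  simp [boundary, LinearMap.sum_apply]

theorem wordBoundary_ofFn {p : ℕ} (x : Fin (p + 1) → α) :
    wordBoundary R (List.ofFn x) = ∑ i : Fin (p + 1),
      (-1 : ℤ) ^ (i : ℕ) • Finsupp.single (List.ofFn fun j => x (i.succAbove j)) 1 := by
  induction p with
  | zero => simp [wordBoundary]
  | succ p ih =>
    rw [List.ofFn_succ, wordBoundary, ih, Fin.sum_univ_succ (n := p + 1), map_sum, sub_eq_add_neg]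
    simp only [Fin.succAbove_zero, Fin.val_zero, pow_zero, one_smul, Fin.val_succ, map_zsmul,
      prepend_single, List.ofFn_succ (n := p), Fin.succ_succAbove_zero, Fin.succ_succAbove_succ,
      pow_succ, mul_neg, mul_one, neg_smul, sum_neg_distrib]

variable (R α) in
/-- The embedding of the chains on injections into the chains on words. -/
def toWord (p : ℕ) : ((Fin p ↪ α) →₀ R) →ₗ[R] (List α →₀ R) :=
  Finsupp.lmapDomain R R fun x => List.ofFn x

@[simp]
theorem toWord_single {p : ℕ} (x : Fin p ↪ α) (r : R) :
    toWord R α p (Finsupp.single x r) = Finsupp.single (List.ofFn x) r :=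
  Finsupp.mapDomain_single

theorem toWord_injective (p : ℕ) : Function.Injective (toWord R α p) :=
  Finsupp.mapDomain_injective fun _ _ h => DFunLike.coe_injective (List.ofFn_injective h)

theorem chainBoundary_toWord {p : ℕ} (z : (Fin (p + 1) ↪ α) →₀ R) :
    chainBoundary (toWord R α (p + 1) z) = toWord R α p (boundary R α p z) := by
  have key : chainBoundary ∘ₗ toWord R α (p + 1) = toWord R α p ∘ₗ boundary R α p := by
    refine Finsupp.lhom_ext' fun x => LinearMap.ext_ring ?_
    simp only [LinearMap.comp_apply, Finsupp.lsingle_apply, toWord_single,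
      chainBoundary_single_one, wordBoundary_ofFn, boundary_single, map_sum, map_zsmul]
    rfl
  exact LinearMap.congr_fun key z

theorem boundary_zero_surjective [Nonempty α] : Function.Surjective (boundary R α 0) := by
  obtain ⟨x⟩ : Nonempty (Fin 1 ↪ α) := ‹Nonempty α›.map fun a =>
    ⟨fun _ => a, Function.injective_of_subsingleton _⟩
  refine fun z => ⟨Finsupp.single x (z default), ?_⟩
  rw [boundary_single, Fin.sum_univ_one, Fin.val_zero, pow_zero, one_smul,
    Subsingleton.elim (face 0 x) default, ← Finsupp.unique_single z]

theorem boundary_boundary {p : ℕ} (z : (Fin (p + 2) ↪ α) →₀ R) :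
    boundary R α p (boundary R α (p + 1) z) = 0 :=
  toWord_injective p <| by
    rw [← chainBoundary_toWord, ← chainBoundary_toWord, chainBoundary_chainBoundary, map_zero]

variable [Fintype α]

theorem range_toWord (p : ℕ) : LinearMap.range (toWord R α p) = injectiveChains R univ p := by
  rw [LinearMap.range_eq_map, ← Finsupp.supported_univ, toWord, Finsupp.lmapDomain_supported,
    Set.image_univ, injectiveChains]
  congr 1
  ext w
  constructor
  · rintro ⟨x, rfl⟩
    exact ⟨List.nodup_ofFn.2 x.injective, by simp, by simp⟩
  · rintro ⟨hw, -, rfl⟩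
    exact ⟨⟨w.get, List.nodup_iff_injective_get.1 hw⟩, List.ofFn_get w⟩

theorem exists_boundary_eq {p : ℕ} (hp : p + 1 < Fintype.card α) {z : (Fin (p + 1) ↪ α) →₀ R}
    (hz : boundary R α p z = 0) : ∃ y, boundary R α (p + 1) y = z := by
  have hmem : toWord R α (p + 1) z ∈ injectiveChains R univ (p + 1) :=
    range_toWord (R := R) (α := α) (p + 1) ▸ ⟨z, rfl⟩
  obtain ⟨y, hy, hyz⟩ := isAcyclicBelowTop univ (p + 1) hp _ hmem
    (by rw [chainBoundary_toWord, hz, map_zero])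
  rw [← range_toWord] at hy
  obtain ⟨y, rfl⟩ := hy
  exact ⟨y, toWord_injective (p + 1) (by rw [← chainBoundary_toWord, hyz])⟩

end Embeddings

end InjectiveWord

section Spherical

theorem augmentedChainComplex_d_succ (X : DeltaComplex) (k : ℕ) :
    X.augmentedChainComplex.d (k + 2) (k + 1) = ModuleCat.ofHom (X.boundary k) :=
  ChainComplex.of_d (fun k => ModuleCat.of ℤ (X.Simplex k →₀ ℤ))
    (fun k => ModuleCat.ofHom (X.boundary k)) k

theorem boundary_zero_eq_single_augmentation {n : ℕ} (z : (Fin 1 ↪ Fin n) →₀ ℤ) :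
    InjectiveWord.boundary ℤ (Fin n) 0 z =
      Finsupp.single default ((orderedSubsetComplex n).augmentation z) := by
  have key : InjectiveWord.boundary ℤ (Fin n) 0 =
      Finsupp.lsingle default ∘ₗ (orderedSubsetComplex n).augmentation := by
    refine Finsupp.lhom_ext' fun x => LinearMap.ext_ring ?_
    refine (InjectiveWord.boundary_single _ _).trans ?_
    rw [Fin.sum_univ_one, Fin.val_zero, pow_zero, one_smul,
      Subsingleton.elim (InjectiveWord.face 0 x) default]
    exact congrArg (Finsupp.single default)
      ((Finsupp.linearCombination_single ℤ 1 x).trans (one_smul ℤ 1)).symm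
  exact LinearMap.congr_fun key z

theorem boundary_eq_zero_of_augmentedChainComplex_d_eq_zero {n i : ℕ}
    (z : (Fin (i + 1) ↪ Fin n) →₀ ℤ)
    (hz : (orderedSubsetComplex n).augmentedChainComplex.d (i + 1) i z = 0) :
    InjectiveWord.boundary ℤ (Fin n) i z = 0 := by
  cases i with
  | zero =>
    have haug : (orderedSubsetComplex n).augmentation z = 0 := hz
    rw [boundary_zero_eq_single_augmentation, haug, Finsupp.single_zero]
  | succ i =>
    rw [augmentedChainComplex_d_succ] at hz
    exact hz

theorem isSpherical_orderedSubsetComplex (m : ℕ) :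
    (orderedSubsetComplex (m + 1)).IsSpherical m := by
  refine ⟨⟨⟨fun _ => 0, fun _ _ _ => Subsingleton.elim (α := Fin 1) _ _⟩⟩, fun i hi => ?_⟩
  refine isZero_homology_succ_of_exact _ _ fun z hz => ?_
  rw [augmentedChainComplex_d_succ]
  change (Fin (i + 1) ↪ Fin (m + 1)) →₀ ℤ at z
  rcases hi.lt_or_gt with hi | hi
  · exact InjectiveWord.exists_boundary_eq (by simpa using hi)
      (boundary_eq_zero_of_augmentedChainComplex_d_eq_zero z hz)
  · have : IsEmpty (Fin (i + 1) ↪ Fin (m + 1)) :=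
      Function.Embedding.isEmpty_of_card_lt (by simpa using hi)
    exact ⟨0, Subsingleton.elim (α := (Fin (i + 1) ↪ Fin (m + 1)) →₀ ℤ) _ _⟩

end Spherical

section PermutationModules

theorem isIso_iff_of_comp_eq_comp {C : Type*} [Category C] {W X Y Z : C} {a : W ⟶ X} {b : Y ⟶ Z}
    {x : X ⟶ Z} {y : W ⟶ Y} (ha : IsIso a) (hb : IsIso b) (h : a ≫ x = y ≫ b) :
    IsIso x ↔ IsIso y := by
  rw [← isIso_comp_left_iff a x, h, isIso_comp_right_iff]

theorem isIso_map_zero_of_trivial (f : H →* G) {V : Type u} [AddCommGroup V] [Module k V]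
    (φ : Rep.trivial k H V ⟶ res f (Rep.trivial k G V)) (hφ : ∀ v : V, φ.hom v = v) :
    IsIso (map f φ 0) := by
  have hH : IsIso (H0π (Rep.trivial k H V)) := H0IsoOfIsTrivial_inv_eq_π (Rep.trivial k H V) ▸
    inferInstance
  have hG : IsIso (H0π (Rep.trivial k G V)) := H0IsoOfIsTrivial_inv_eq_π (Rep.trivial k G V) ▸
    inferInstance
  have hid : φ.toModuleCatHom = 𝟙 (ModuleCat.of k V) := ModuleCat.hom_ext (LinearMap.ext hφ)
  refine (isIso_iff_of_comp_eq_comp hH hG (H0π_comp_map f φ)).2 ?_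
  rw [hid]
  infer_instance

instance (n : ℕ) : (groupHomology.functor k G n).Additive where
  map_add {A B φ ψ} := by
    have hadd : chainsMap (.id G) (φ + ψ) = chainsMap (.id G) φ + chainsMap (.id G) ψ :=
      HomologicalComplex.hom_ext _ _ fun i => ModuleCat.hom_ext <| Finsupp.lhom_ext fun x a =>
        (chainsMap_f_single _ _ _ x a).trans <| (Finsupp.single_add _ _ _).trans <|
          (congrArg₂ (· + ·) (chainsMap_f_single (.id G) φ _ x a)
            (chainsMap_f_single (B := B) (.id G) ψ _ x a)).symm
    exact (congrArg (HomologicalComplex.homologyMap · n) hadd).trans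
      (HomologicalComplex.homologyMap_add _ _ n)

theorem map_sum_zsmul_hom {A B : Rep.{u} k G} {M ι : Type*} [AddCommGroup M] [Module k M]
    (L : B →ₗ[k] M) (s : Finset ι) (c : ι → ℤ) (φ : ι → (A ⟶ B)) (z : A) :
    L ((∑ i ∈ s, c i • φ i).hom z) = ∑ i ∈ s, c i • L ((φ i).hom z) := by
  rw [Rep.sum_hom]
  refine (congrArg L (Representation.IntertwiningMap.sum_apply _ _ _ _ _)).trans ?_
  exact (map_sum L _ _).trans (Finset.sum_congr rfl fun i _ => map_zsmul L _ _)

variable {X Y : Type u} [MulAction G X] [MulAction G Y]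

variable (k) in
/-- The morphism of permutation modules induced by an equivariant map. -/
def permMap (φ : X →[G] Y) : ofMulAction k G X ⟶ ofMulAction k G Y :=
  homMk (MonoidAlgebra.mapDomainLinearMap k k φ) fun g a => by
    have hcomp : MonoidAlgebra.mapDomainLinearMap k k φ ∘ₗ (ofMulAction k G X).ρ g =
        (ofMulAction k G Y).ρ g ∘ₗ MonoidAlgebra.mapDomainLinearMap k k φ :=
      MonoidAlgebra.lhom_ext' fun x => LinearMap.ext_ring <| by simp
    exact LinearMap.congr_fun hcomp a

theorem permMap_single (φ : X →[G] Y) (x : X) (r : k) :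
    (permMap k φ).hom (MonoidAlgebra.single x r) = MonoidAlgebra.single (φ x) r :=
  MonoidAlgebra.mapDomainLinearMap_single ..

variable {f : H →* G} {x₀ : X}

variable (k) in
/-- The map `k ⟶ k[X]` with value the point `x₀`, covering a homomorphism into the stabilizer
of `x₀`. -/
def pointHom (f : H →* G) (x₀ : X) (hx₀ : ∀ h, f h • x₀ = x₀) :
    Rep.trivial k H k ⟶ res f (ofMulAction k G X) :=
  homMk (A := Rep.trivial k H k) (B := res f (ofMulAction k G X)) (MonoidAlgebra.lsingle x₀)
    fun h r => by
      refine Eq.trans ?_ (Representation.ofMulAction_single (f h) x₀ r).symm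
      rw [hx₀]
      rfl

theorem map_comp_mapCoeff {A : Rep.{u} k H} {B C : Rep.{u} k G} (φ : A ⟶ res f B) (ψ : B ⟶ C)
    (n : ℕ) : map f φ n ≫ mapCoeff ψ n = map f (φ ≫ (resFunctor f).map ψ) n :=
  (map_comp f (.id G) φ ψ n).symm

theorem map_pointHom_comp_permMap (hx₀ : ∀ h, f h • x₀ = x₀) (φ : X →[G] Y)
    (hφx₀ : ∀ h, f h • φ x₀ = φ x₀) (n : ℕ) :
    map f (pointHom k f x₀ hx₀) n ≫ mapCoeff (permMap k φ) n =
      map f (pointHom k f (φ x₀) hφx₀) n := by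
  rw [map_comp_mapCoeff]
  congr 1
  exact hom_ext_apply fun r => permMap_single φ x₀ r

theorem map_comp_map_pointHom {K : Type u} [Group K] (f' : K →* H)
    {φ : Rep.trivial k K k ⟶ res f' (Rep.trivial k H k)} (hφ : ∀ r : k, φ.hom r = r)
    (hx₀ : ∀ h, f h • x₀ = x₀) (hx₀' : ∀ h, f.comp f' h • x₀ = x₀) (n : ℕ) :
    map f' φ n ≫ map f (pointHom k f x₀ hx₀) n =
      map (f.comp f') (pointHom k (f.comp f') x₀ hx₀') n := by
  rw [← map_comp]
  congr 1
  exact hom_ext_apply fun r => congrArg (MonoidAlgebra.single x₀) (hφ r)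

theorem map_pointHom_smul (hx₀ : ∀ h, f h • x₀ = x₀) {g : G} (hg : ∀ h, Commute g (f h))
    (hgx₀ : ∀ h, f h • g • x₀ = g • x₀) (n : ℕ) :
    map f (pointHom k f (g • x₀) hgx₀) n = map f (pointHom k f x₀ hx₀) n := by
  have hf : (MulAut.conj g).toMonoidHom.comp f = f := MonoidHom.ext fun h => by simp [(hg h).eq]
  have hcomp := map_comp f (MulAut.conj g).toMonoidHom (pointHom k f x₀ hx₀)
    (conjHom g (ofMulAction k G X)) n
  rw [map_conj_eq_id, Category.comp_id] at hcomp
  rw [← hcomp]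
  refine map_congr hf.symm (LinearMap.ext fun r => ?_) n
  exact (Representation.ofMulAction_single g x₀ r).symm

theorem isIso_map_pointHom [MulAction.IsPretransitive G X] (hf : Function.Injective f)
    (hstab : MulAction.stabilizer G x₀ = f.range) (hx₀ : ∀ h, f h • x₀ = x₀) (n : ℕ) :
    IsIso (map f (pointHom k f x₀ hx₀) n) := by
  have hpoint : stabilizerHom hstab (𝟙_ (Rep k G)) ≫ (resFunctor f).map
      (ρ_ (ofMulAction k G X)).hom = pointHom k f x₀ hx₀ :=
    hom_ext_apply fun r => by
      refine (TensorProduct.rid_tmul (MonoidAlgebra.single x₀ (1 : k)) r).trans ?_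
      rw [MonoidAlgebra.smul_single, smul_eq_mul, mul_one]
      rfl
  have hcomp : map f (stabilizerHom hstab (𝟙_ (Rep k G))) n ≫
      (groupHomology.functor k G n).map (ρ_ (ofMulAction k G X)).hom =
        map f (pointHom k f x₀ hx₀) n :=
    (map_comp_mapCoeff _ _ n).trans (congrArg (map f · n) hpoint)
  rw [← hcomp]
  exact IsIso.comp_isIso' (isIso_map_stabilizerHom hf hstab _ n) (Functor.map_isIso _ _)

end PermutationModules

section ViaEmbedding

open Equiv.Perm (viaEmbeddingHom viaEmbedding_apply viaEmbedding_apply_of_notMem)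

variable {α β ι : Type*} {j : β ↪ α} {e : ι ↪ α}

theorem viaEmbeddingHom_smul_eq_self (h : Disjoint (Set.range j) (Set.range e))
    (σ : Equiv.Perm β) : viaEmbeddingHom j σ • e = e :=
  DFunLike.ext _ _ fun i =>
    viaEmbedding_apply_of_notMem σ j (e i) (h.notMem_of_mem_right ⟨i, rfl⟩)

theorem commute_viaEmbeddingHom (h : Disjoint (Set.range j) (Set.range e)) (τ : Equiv.Perm ι)
    (σ : Equiv.Perm β) : Commute (viaEmbeddingHom e τ) (viaEmbeddingHom j σ) :=
  Equiv.Perm.Disjoint.commute fun y => by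
    by_cases hy : y ∈ Set.range e
    · exact .inr (viaEmbedding_apply_of_notMem σ j y (h.notMem_of_mem_right hy))
    · exact .inl (viaEmbedding_apply_of_notMem τ e y hy)

theorem stabilizer_eq_range_viaEmbeddingHom (h : IsCompl (Set.range j) (Set.range e)) :
    MulAction.stabilizer (Equiv.Perm α) e = (viaEmbeddingHom j).range := by
  ext g
  rw [MulAction.mem_stabilizer_iff]
  constructor
  · intro hg
    have hge (i : ι) : g (e i) = e i := DFunLike.congr_fun hg i
    have hmem (y : α) : g y ∈ Set.range j ↔ y ∈ Set.range j := by
      rw [h.eq_compl, Set.mem_compl_iff, Set.mem_compl_iff, not_iff_not]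
      constructor
      · rintro ⟨i, hi⟩
        exact ⟨i, g.injective ((hge i).trans hi)⟩
      · rintro ⟨i, rfl⟩
        exact ⟨i, (hge i).symm⟩
    let σ : Equiv.Perm β := (Equiv.ofInjective j j.injective).symm.permCongr (g.subtypePerm hmem)
    refine ⟨σ, Equiv.ext fun y => ?_⟩
    by_cases hy : y ∈ Set.range j
    · obtain ⟨b, rfl⟩ := hy
      exact (viaEmbedding_apply σ j b).trans (Equiv.apply_ofInjective_symm j.injective _)
    · obtain ⟨i, rfl⟩ : y ∈ Set.range e := by rwa [h.symm.eq_compl]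
      exact (viaEmbedding_apply_of_notMem σ j _ hy).trans (hge i).symm
  · rintro ⟨σ, rfl⟩
    exact viaEmbeddingHom_smul_eq_self h.disjoint σ

theorem viaEmbeddingHom_comp_stabilization {m : ℕ} (j : Fin (m + 1) ↪ α) :
    (viaEmbeddingHom j).comp (SymmetricGroup.stabilization m) =
      viaEmbeddingHom (Fin.castSuccEmb.trans j) := by
  refine MonoidHom.ext fun σ => Equiv.ext fun y => ?_
  change Equiv.Perm.viaEmbedding (SymmetricGroup.stabilization m σ) j y =
    Equiv.Perm.viaEmbedding σ (Fin.castSuccEmb.trans j) y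
  by_cases hy : y ∈ Set.range j
  · obtain ⟨i, rfl⟩ := hy
    rw [viaEmbedding_apply]
    cases i using Fin.lastCases with
    | last =>
      rw [SymmetricGroup.stabilization_last, viaEmbedding_apply_of_notMem]
      rintro ⟨i, hi⟩
      exact Fin.castSucc_ne_last i (j.injective hi)
    | cast i =>
      rw [SymmetricGroup.stabilization_castSucc]
      exact (viaEmbedding_apply σ (Fin.castSuccEmb.trans j) i).symm
  · rw [viaEmbedding_apply_of_notMem _ _ _ hy, viaEmbedding_apply_of_notMem]
    rintro ⟨i, rfl⟩
    exact hy ⟨i.castSucc, rfl⟩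

instance (α ι : Type*) [Finite ι] : MulAction.IsPretransitive (Equiv.Perm α) (ι ↪ α) :=
  ⟨Equiv.Perm.exists_smul_eq_embedding⟩

end ViaEmbedding

namespace InjectiveWord

section Representations

open Equiv.Perm (viaEmbeddingHom viaEmbeddingHom_injective)

variable {α β : Type u} {p : ℕ}

variable (k α) in
/-- The permutation representation of the symmetric group on the injective words of length `p`. -/
abbrev wordRep (p : ℕ) : Rep.{u} k (Equiv.Perm α) :=
  ofMulAction k (Equiv.Perm α) (Fin p ↪ α)

/-- The map `face i`, as an equivariant map. -/
def faceHom (i : Fin (p + 1)) : (Fin (p + 1) ↪ α) →[Equiv.Perm α] (Fin p ↪ α) where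
  toFun := face i
  map_smul' _ _ := rfl

variable (k α) in
/-- The boundary operator, as a morphism of representations. -/
def boundaryHom (p : ℕ) : wordRep k α (p + 1) ⟶ wordRep k α p :=
  ∑ i : Fin (p + 1), (-1 : ℤ) ^ (i : ℕ) • permMap k (faceHom i)

theorem coeff_boundaryHom (z : wordRep k α (p + 1)) :
    ((boundaryHom k α p).hom z).coeff = boundary k α p z.coeff := by
  have key : (coeffLinearEquiv k).toLinearMap ∘ₗ (boundaryHom k α p).hom.toLinearMap =
      boundary k α p ∘ₗ (coeffLinearEquiv k).toLinearMap := by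
    refine MonoidAlgebra.lhom_ext' fun x => LinearMap.ext_ring ?_
    let L : wordRep k α p →ₗ[k] ((Fin p ↪ α) →₀ k) := (coeffLinearEquiv k).toLinearMap
    refine Eq.trans ?_ (boundary_single x 1).symm
    refine (map_sum_zsmul_hom L _ _ _ _).trans (Finset.sum_congr rfl fun i _ => ?_)
    exact congrArg (fun y => (-1 : ℤ) ^ (i : ℕ) • coeff y) (permMap_single (faceHom i) x 1)
  exact LinearMap.congr_fun key z

theorem boundaryHom_comp_boundaryHom (p : ℕ) :
    boundaryHom k α (p + 1) ≫ boundaryHom k α p = 0 :=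
  hom_ext_apply fun z => MonoidAlgebra.coeff_injective <| by
    refine (coeff_boundaryHom _).trans ?_
    exact (congrArg _ (coeff_boundaryHom z)).trans (boundary_boundary z.coeff)

theorem epi_boundaryHom_zero [Nonempty α] : Epi (boundaryHom k α 0) :=
  (Rep.epi_iff_surjective _).2 fun z => by
    obtain ⟨y, hy⟩ := boundary_zero_surjective z.coeff
    exact ⟨ofCoeff y, MonoidAlgebra.coeff_injective ((coeff_boundaryHom _).trans hy)⟩

theorem epi_toKernel_boundaryHom [Fintype α] (hp : p + 1 < Fintype.card α) :
    Epi (toKernel (boundaryHom_comp_boundaryHom (k := k) (α := α)) p) := by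
  refine (ShortComplex.exact_iff_epi_kernel_lift
    (ShortComplex.mk _ _ (boundaryHom_comp_boundaryHom (k := k) (α := α) p))).1 ?_
  refine exact_iff_function_exact.2 fun z => ⟨fun hz => ?_, ?_⟩
  · obtain ⟨y, hy⟩ := exists_boundary_eq hp ((coeff_boundaryHom z).symm.trans (congrArg coeff hz))
    exact ⟨ofCoeff y, MonoidAlgebra.coeff_injective ((coeff_boundaryHom _).trans hy)⟩
  · rintro ⟨y, rfl⟩
    exact congrArg (fun φ => φ.hom y) (boundaryHom_comp_boundaryHom (k := k) (α := α) p)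

variable {j : β ↪ α} {e : Fin (p + 1) ↪ α}

/-- The faces of `e` differ by permutations of the letters of `e`, which commute with the
permutations of the letters in the range of `j`. -/
theorem map_pointHom_face_eq (h : Disjoint (Set.range j) (Set.range e)) (i : Fin (p + 1))
    (hi : ∀ σ, viaEmbeddingHom j σ • face i e = face i e)
    (h₀ : ∀ σ, viaEmbeddingHom j σ • face 0 e = face 0 e) (q : ℕ) :
    map (viaEmbeddingHom j) (pointHom k _ (face i e) hi) q =
      map (viaEmbeddingHom j) (pointHom k _ (face 0 e) h₀) q := by
  have hface : face i e = viaEmbeddingHom e i.cycleRange.symm • face 0 e :=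
    DFunLike.ext _ _ fun l => (congrArg e (Fin.cycleRange_symm_succ i l).symm).trans
      (Equiv.Perm.viaEmbedding_apply i.cycleRange.symm e l.succ).symm
  rw [← map_pointHom_smul h₀ (commute_viaEmbeddingHom h i.cycleRange.symm)
    (fun σ => hface ▸ hi σ)]
  congr 2

theorem sum_neg_one_pow_fin (p : ℕ) :
    ∑ i : Fin (p + 1), (-1 : ℤ) ^ (i : ℕ) = if Even p then 1 else 0 := by
  rw [Fin.sum_univ_eq_sum_range (fun i => (-1 : ℤ) ^ i), neg_one_geom_sum]
  by_cases h : Even p <;> simp [h, Nat.even_add_one]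

theorem map_pointHom_comp_boundaryHom (h : Disjoint (Set.range j) (Set.range e))
    (he : ∀ σ, viaEmbeddingHom j σ • e = e)
    (h₀ : ∀ σ, viaEmbeddingHom j σ • face 0 e = face 0 e) (q : ℕ) :
    map (viaEmbeddingHom j) (pointHom k _ e he) q ≫ mapCoeff (boundaryHom k α p) q =
      (if Even p then 1 else 0 : ℤ) • map (viaEmbeddingHom j) (pointHom k _ (face 0 e) h₀) q := by
  have hsum : mapCoeff (boundaryHom k α p) q =
      ∑ i : Fin (p + 1), (-1 : ℤ) ^ (i : ℕ) • mapCoeff (permMap k (faceHom i)) q := by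
    exact ((groupHomology.functor k (Equiv.Perm α) q).map_sum _ _).trans
      (Finset.sum_congr rfl fun i _ => Functor.map_zsmul _)
  rw [hsum, Preadditive.comp_sum, ← sum_neg_one_pow_fin, Finset.sum_smul]
  refine Finset.sum_congr rfl fun i _ => ?_
  have hi (σ : Equiv.Perm β) : viaEmbeddingHom j σ • face i e = face i e :=
    congrArg (face i) (he σ)
  rw [Preadditive.comp_zsmul, ← map_pointHom_face_eq h i hi h₀]
  exact congrArg _ (map_pointHom_comp_permMap he (faceHom i) hi q)

theorem isIso_map_pointHom_viaEmbeddingHom {e : Fin p ↪ α}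
    (h : IsCompl (Set.range j) (Set.range e)) (q : ℕ) :
    IsIso (map (viaEmbeddingHom j)
      (pointHom k _ e (viaEmbeddingHom_smul_eq_self h.disjoint)) q) :=
  isIso_map_pointHom (viaEmbeddingHom_injective j) (stabilizer_eq_range_viaEmbeddingHom h) _ q

theorem mapCoeff_boundaryHom_eq_zero (hp : Odd p) (e : Fin (p + 1) ↪ α) (q : ℕ) :
    mapCoeff (boundaryHom k α p) q = 0 := by
  let j : {y // y ∉ Set.range e} ↪ α := .subtype _
  have h : IsCompl (Set.range j) (Set.range e) := by
    have hj : Set.range j = (Set.range e)ᶜ := Subtype.range_coe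
    exact hj ▸ isCompl_compl.symm
  have hcomp := map_pointHom_comp_boundaryHom (k := k) h.disjoint
    (viaEmbeddingHom_smul_eq_self h.disjoint)
    (fun σ => congrArg (face 0) (viaEmbeddingHom_smul_eq_self h.disjoint σ)) q
  rw [if_neg (Nat.not_even_iff_odd.2 hp), zero_smul] at hcomp
  have := isIso_map_pointHom_viaEmbeddingHom (k := k) h q
  exact Limits.zero_of_epi_comp _ hcomp

end Representations

end InjectiveWord

section Stability

open Equiv.Perm (viaEmbeddingHom)
open InjectiveWord SymmetricGroup

theorem map_pointHom_comp_stabilization {α : Type} {m p : ℕ} {j : Fin (m + 1) ↪ α}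
    {x : Fin p ↪ α} (hx : ∀ σ, viaEmbeddingHom j σ • x = x)
    (hx' : ∀ σ, viaEmbeddingHom (Fin.castSuccEmb.trans j) σ • x = x) (q : ℕ) :
    homologyStabilization m q ≫ map (viaEmbeddingHom j) (pointHom ℤ _ x hx) q =
      map (viaEmbeddingHom (Fin.castSuccEmb.trans j)) (pointHom ℤ _ x hx') q := by
  rw! [← viaEmbeddingHom_comp_stabilization j]
  exact map_comp_map_pointHom (stabilization m) (fun _ => rfl) hx _ q

theorem isIso_mapCoeff_boundaryHom_iff_of_isCompl {α : Type} {m p : ℕ} (hp : Even p)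
    {j : Fin (m + 1) ↪ α} {e : Fin (p + 1) ↪ α}
    (he : IsCompl (Set.range (Fin.castSuccEmb.trans j)) (Set.range e))
    (hface : IsCompl (Set.range j) (Set.range (face 0 e))) (q : ℕ) :
    IsIso (mapCoeff (boundaryHom ℤ α p) q) ↔ IsIso (homologyStabilization m q) := by
  have hfix := viaEmbeddingHom_smul_eq_self he.disjoint
  have hpoint := map_pointHom_comp_boundaryHom (k := ℤ) he.disjoint hfix
    (fun σ => congrArg (face 0) (hfix σ)) q
  rw [if_pos hp, one_smul] at hpoint
  exact isIso_iff_of_comp_eq_comp (isIso_map_pointHom_viaEmbeddingHom he q)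
    (isIso_map_pointHom_viaEmbeddingHom hface q) (hpoint.trans
      (map_pointHom_comp_stabilization (viaEmbeddingHom_smul_eq_self hface.disjoint) _ q).symm)

theorem isCompl_range_of_val_eq {a b n : ℕ} (hn : n = a + b) {f : Fin a → Fin n}
    {g : Fin b → Fin n} (hf : ∀ i, (f i : ℕ) = i) (hg : ∀ i, (g i : ℕ) = a + i) :
    IsCompl (Set.range f) (Set.range g) := by
  refine ⟨Set.disjoint_range_iff.2 fun i l h => ?_, codisjoint_iff_le_sup.2 fun i _ => ?_⟩
  · have := hf i
    have := hg l
    omega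
  · rcases lt_or_ge (i : ℕ) a with hi | hi
    · exact .inl ⟨⟨i, hi⟩, Fin.ext (hf _)⟩
    · exact .inr ⟨⟨i - a, by omega⟩, Fin.ext ((hg _).trans (Nat.add_sub_of_le hi))⟩

theorem isIso_mapCoeff_boundaryHom_iff (m : ℕ) {p : ℕ} (hp : Even p) (q : ℕ) :
    IsIso (mapCoeff (boundaryHom ℤ (Fin (m + (p + 1))) p) q) ↔
      IsIso (homologyStabilization m q) :=
  isIso_mapCoeff_boundaryHom_iff_of_isCompl (j := Fin.castLEEmb (by omega)) (e := Fin.natAddEmb m)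
    hp (isCompl_range_of_val_eq rfl (fun _ => rfl) fun _ => rfl)
    (isCompl_range_of_val_eq (by omega) (fun _ => rfl)
      fun _ => (Nat.succ_add_eq_add_succ _ _).symm) q

theorem isIso_homologyStabilization {m r : ℕ} (h : 2 * r < m + 1) :
    IsIso (homologyStabilization m r) := by
  induction r using Nat.strong_induction_on generalizing m with
  | _ r ih =>
    cases r with
    | zero => exact isIso_map_zero_of_trivial _ _ fun _ => rfl
    | succ r =>
      have hiso (p q : ℕ) (hp : Even p) (hq : q ≤ r) (hpq : 2 * q + p < m + 1) :
          IsIso (mapCoeff (boundaryHom ℤ (Fin (m + 1)) p) q) := by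
        obtain ⟨l, rfl⟩ : ∃ l, m = l + p := ⟨m - p, by omega⟩
        exact (isIso_mapCoeff_boundaryHom_iff l hp q).2 (ih q (by omega) (by omega))
      have := epi_boundaryHom_zero (k := ℤ) (α := Fin (m + 1))
      rw [← isIso_mapCoeff_boundaryHom_iff m (p := 0) .zero]
      exact isIso_mapCoeff_succ_of_acyclic boundaryHom_comp_boundaryHom
        (fun p hp => epi_toKernel_boundaryHom (by rwa [Fintype.card_fin])) hiso h
        (mapCoeff_boundaryHom_eq_zero odd_one (Fin.castLEEmb (by omega)) (r + 1))

end Stability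

end HomologicalStability

end

theorem mainTheorem4 :
    (∀ m r : ℕ, 2 * r < m + 1 →
      CategoryTheory.IsIso (SymmetricGroup.homologyStabilization m r)) ∧
    (∀ m : ℕ, (orderedSubsetComplex (m + 1)).IsSpherical m) :=
  ⟨fun _ _ => HomologicalStability.isIso_homologyStabilization,
    HomologicalStability.isSpherical_orderedSubsetComplex⟩
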